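/- Let $(X,d,\nu)$ be a computable metric space, i.e. $(X,d)$ is a metric space with a dense sequence $\nu:\mathbb N\to X$ such that the reals $d(\nu(i),\nu(j))$ are computable uniformly in $i,j$. Names are elements of $\mathbb N^{\mathbb N}$; $\langle\cdot,\dots\rangle$ denotes the standard computable tuplings of numbers and of (finitely or countably many) names. For representations $\delta,\delta'$ of sets contained in a common set, $\delta\le\delta'$ means that some computable $F:\subseteq\mathbb N^{\mathbb N}\to\mathbb N^{\mathbb N}$ maps every $\delta$-name of a point to a $\delta'$-name of the same point; $\delta|^{S}$ is the restriction of $\delta$ to the names of elements of $S$; a $(\delta\sqcap\delta')$-name of $y$ is a pair $\langle p,q\rangle$ of a $\delta$-name $p$ and a $\delta'$-name $q$ of $y$. Fix standard numberings $\nu_{\mathbb Q}$ of $\mathbb Q$ and $\nu_{\mathbb Q^+}$ of the positive rationals; let $\alpha\langle a,r\rangle=B(\nu(a);\nu_{\mathbb Q^+}(r))$, $\alpha'(0)=\emptyset$ and $\alpha'(n+1)=\alpha(n)$. A $\delta_X$-name of $x\in X$ is a $p$ with $d(\nu(p_i),\nu(p_j))<2^{-\min\{i,j\}}$ for all $i,j$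 and $\nu(p_i)\to x$. A $\delta_{\Sigma^0_1}$-name of an open set $U$ is a $p$ with $U=\bigcup_i\alpha'(p_i)$. Let $\mathcal A(X)$ be the class of closed subsets of $X$ and $\mathcal A'=\mathcal A(X)\setminus\{\emptyset,X\}$. The following are representations of closed sets $A$. * A $\delta_{\Pi^0_1}$-name of $A$ is a $\delta_{\Sigma^0_1}$-name of $X\setminus A$. * A $\delta_{\mathrm{range}}$-name of $A\ne\emptyset$ is a tuple $\langle p^{(0)},p^{(1)},\dots\rangle$ such that all entries of all $p^{(i)}$ are positive and the sequences $p^{(i)}-1$ (entrywise) are $\delta_X$-names of points that form a dense subset of $A$; the only $\delta_{\mathrm{range}}$-name of $\emptyset$ is $0^\omega$. * A $\delta_{\mathrm{dist}}^{>}$-name of $A$ is a $p$ such that $\eta_p$ maps each $\delta_X$-name of each $x\in X$ to some $q$ with $\{n:\nu_{\mathbb Q}(n)<d(x,A)\}=\{q_i-1: q_i\ge 1\}$, where $d(x,\emptyset)=\infty$ and $\eta$ is the canonical representation of the continuous partial functions $\subseteq\mathbb N^{\mathbb N}\to\mathbb N^{\mathbb N}$ with $G_\delta$ domain. * A Dugundji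 system for $A\neq\emptyset$ (with coefficient $2$) consists of open sets $(V_i)_{i\in\mathbb N}$ and points $(y_i)_{i\in\mathbb N}$ of $A$ such that $\bigcup_iV_i=X\setminus A$, each point of $\bigcup_i V_i$ has a neighbourhood meeting only finitely many $V_j$, $d(x,y_i)\le 2\,d(x,A)$ for all $i$ and $x\in V_i$, and for every sequence $(n_i)_i$ in $\mathbb N$, $d(V_{n_i},A)\to0$ implies $\operatorname{diam}V_{n_i}\to0$. A $\delta_4$-name of $A$ is a name $\langle\langle p,q,r\rangle,s\rangle$ for which there is a Dugundji system $((V_i)_i,(y_i)_i)$ for $A$ such that $p=\langle p^{(0)},\dots\rangle$ with $p^{(i)}$ a $\delta_{\Sigma^0_1}$-name of $V_i$ for each $i$; $\bigcup_iV_i=\bigcup_i\alpha'(q_i)$; for each $i$, $\{j: V_j\cap\alpha'(q_i)\ne\emptyset\}$ is contained in the finite set with binary code $r_i$; and $s=\langle s^{(0)},\dots\rangle$ with $s^{(i)}$ a $\delta_X$-name of $y_i$ for each $i$. * A $\delta_8$-name of $A\ne\emptyset$ is a pair $\langle p,q\rangle$ such that $p$ is a $\delta_{\mathrm{range}}$-name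 of some closed set $B$ with $\partial A\subseteq B\subseteq A$, and $q$ is a $\delta_{\Pi^0_1}$-name of $A$. Then $$(\delta_{\mathrm{range}}\sqcap\delta_{\mathrm{dist}}^{>})|^{\mathcal A'}\;\le\;\delta_4|^{\mathcal A'}\;\le\;\delta_8|^{\mathcal A'}.$$ -/

import Mathlib

open TopologicalSpace Filter Topology

namespace Dugundji

/-! Baire space, tuplings, and computable partial functions on it -/

/-- Baire space, the set of names. -/
abbrev Baire : Type := ℕ → ℕ

/-- The word formed by the first `n` entries of `p`. -/
def word (p : Baire) (n : ℕ) : List ℕ := (List.range n).map p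

/-- A partial function on Baire space is (Type-2) computable if it is the limit `h_ω` of a
computable prefix-monotone word function `h`: reading longer and longer prefixes of `p`, one
writes longer and longer prefixes of `F p`, and `F p` is defined exactly when the output written
is infinite. -/
def IsComputable (F : Baire →. Baire) : Prop :=
  ∃ h : List ℕ → List ℕ, Computable h ∧ (∀ u v, u <+: v → h u <+: h v) ∧
    ∀ p q, q ∈ F p ↔ ∀ n, ∃ k, word q n <+: h (word p k)

/-- The components of a pair `⟨p⁽⁰⁾, p⁽¹⁾⟩` (interleaving), `j < 2`. -/
def proj2 (s : Baire) (j : ℕ) : Baire := fun n => s (2 * n + j)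

/-- The components of a triple `⟨p⁽⁰⁾, p⁽¹⁾, p⁽²⁾⟩` (interleaving), `j < 3`. -/
def proj3 (s : Baire) (j : ℕ) : Baire := fun n => s (3 * n + j)

/-- The components of an infinite tuple `s = ⟨p⁽⁰⁾, p⁽¹⁾, …⟩`, where `s ⟨j, k⟩ = p⁽ʲ⁾ k`. -/
def projω (s : Baire) (j : ℕ) : Baire := fun k => s (Nat.pair j k)

/-- The canonical representation `η` of the continuous partial functions on Baire space with
`G_δ` domain, by Kleene associates: the value `η_p(q)(n)` is `m` if the first nonzero number among
`p ⟨n, q↾0⟩, p ⟨n, q↾1⟩, …` exists and equals `m + 1`. -/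
def eta (p : Baire) : Baire →. Baire := fun q =>
  ⟨∀ n, ∃ k, p (Nat.pair n (Encodable.encode (word q k))) ≠ 0,
   fun h n => p (Nat.pair n (Encodable.encode (word q (Nat.find (h n))))) - 1⟩

/-! Representations -/

/-- A representation `δ :⊆ ℕ^ℕ → Y`, given by its graph: `δ p y` says that `p` is a
`δ`-name of `y`. -/
abbrev Rep (Y : Type*) := Baire → Y → Prop

/-- Reducibility `δ ≤ δ'`: some computable partial function turns every `δ`-name of a point into
a `δ'`-name of the same point. -/
def Rep.Reducible {Y : Type*} (δ δ' : Rep Y) : Prop :=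
  ∃ F : Baire →. Baire, IsComputable F ∧ ∀ p y, δ p y → ∃ q ∈ F p, δ' q y

/-- The restriction `δ|^S` of a representation to the names of elements of `S`. -/
def Rep.restrict {Y : Type*} (δ : Rep Y) (S : Set Y) : Rep Y := fun p y => y ∈ S ∧ δ p y

/-- The meet `δ ⊓ δ'`: a name is a pair of a `δ`-name and a `δ'`-name. -/
def Rep.meet {Y : Type*} (δ δ' : Rep Y) : Rep Y := fun s y => δ (proj2 s 0) y ∧ δ' (proj2 s 1) y

/-- The representation `δ^ω` of sequences. -/
def Rep.seq {Y : Type*} (δ : Rep Y) : Rep (ℕ → Y) := fun s y => ∀ i, δ (projω s i) (y i)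

/-- The representation `δ ∘ P`, where `P` subtracts `1` from each entry of a sequence of positive
numbers and is undefined elsewhere. -/
def Rep.shift {Y : Type*} (δ : Rep Y) : Rep Y := fun s y => ∃ p, (∀ k, s k = p k + 1) ∧ δ p y

/-- `G` is a `(δ, δ')`-realizer of the total function `f`. -/
def Realizes {Y Z : Type*} (δ : Rep Y) (δ' : Rep Z) (G : Baire →. Baire) (f : Y → Z) : Prop :=
  ∀ p y, δ p y → ∃ q ∈ G p, δ' q (f y)

/-! Rational numbers and the extended reals -/

/-- The standard numbering of the positive rationals, `⟨a, b⟩ ↦ (a + 1) / (b + 1)`. -/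
def nuQpos (n : ℕ) : ℚ := ((n.unpair.1 : ℚ) + 1) / ((n.unpair.2 : ℚ) + 1)

/-- The standard numbering of the rationals, `⟨⟨a, b⟩, c⟩ ↦ (a - b) / (c + 1)`. -/
def nuQ (n : ℕ) : ℚ :=
  ((n.unpair.1.unpair.1 : ℚ) - (n.unpair.1.unpair.2 : ℚ)) / ((n.unpair.2 : ℚ) + 1)

/-- The representation of the extended reals by enumeration of all smaller rationals (an entry `0`
carries no information, an entry `n + 1` lists the rational number with index `n`). -/
def rhoLower : Rep EReal := fun p t => {n | ((nuQ n : ℝ) : EReal) < t} = {n | ∃ i, p i = n + 1}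

/-! Computable metric spaces and their hyperspaces -/

section Metric

variable {X : Type*} [MetricSpace X]

/-- `(X, d, ν)` is a computable metric space: `ν` is a dense sequence, and the reals `d(ν i, ν j)`
are computable uniformly in `i` and `j`. -/
def IsComputableMetricSpace (ν : ℕ → X) : Prop :=
  DenseRange ν ∧ ∃ f : ℕ × ℕ × ℕ → ℕ, Computable f ∧
    ∀ i j k, |dist (ν i) (ν j) - (nuQ (f (i, j, k)) : ℝ)| < (2 : ℝ)⁻¹ ^ k

/-- The Cauchy representation of `X`. -/
def cauchyRep (ν : ℕ → X) : Rep X := fun p x =>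
  (∀ i j, dist (ν (p i)) (ν (p j)) < (2 : ℝ)⁻¹ ^ min i j) ∧
    Tendsto (fun i => ν (p i)) atTop (𝓝 x)

/-- The standard ball numbering `α ⟨a, r⟩ = B(ν a; nuQpos r)`. -/
def ballNum (ν : ℕ → X) (n : ℕ) : Set X := Metric.ball (ν n.unpair.1) (nuQpos n.unpair.2 : ℝ)

/-- The shift of a numbering of sets: `0 ↦ ∅`, `n + 1 ↦ α n`. -/
def shiftNum (α : ℕ → Set X) : ℕ → Set X
  | 0 => ∅
  | n + 1 => α n

/-- The representation of open sets by enumerations of basic balls. -/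
def sigmaRep (ν : ℕ → X) : Rep (Opens X) := fun p U =>
  (U : Set X) = ⋃ i, shiftNum (ballNum ν) (p i)

/-- The representation of closed sets by names of their complements. -/
def piRep (ν : ℕ → X) : Rep (Closeds X) := fun p A => sigmaRep ν p A.compl

/-- The representation `δ_range` of closed sets, by dense sequences of points. -/
def rangeRep (ν : ℕ → X) : Rep (Closeds X) := fun s A =>
  ((A : Set X) = ∅ ∧ ∀ i k, projω s i k = 0) ∨
  ((A : Set X).Nonempty ∧
    (∀ i, ∃ y ∈ A, (cauchyRep ν).shift (projω s i) y) ∧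
    ∀ x ∈ A, ∀ U : Set X, IsOpen U → x ∈ U → ∃ i, ∃ y ∈ U, (cauchyRep ν).shift (projω s i) y)

/-- The representation `δ_dist^>` of closed sets, by `η`-names of realizers of the distance
function `d_A`, as a function with values in the extended reals under `rhoLower`
(`d_∅ = ∞`). -/
def distRep (ν : ℕ → X) : Rep (Closeds X) := fun p A =>
  Realizes (cauchyRep ν) rhoLower (eta p) fun x => ((Metric.infEDist x (A : Set X) : ENNReal) : EReal)

/-! Locally finite sequences and Dugundji systems -/

/-- The sequence `V` is locally finite in its union: each point of each member has a basic
neighbourhood meeting only finitely many members. -/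
def LF (α : ℕ → Set X) (V : ℕ → Opens X) : Prop :=
  ∀ x, ∀ i, x ∈ V i → ∃ a, ∃ S : Finset ℕ, x ∈ α a ∧ {j | ((V j : Set X) ∩ α a).Nonempty} ⊆ S

/-- The representation `δ₁` of locally finite sequences of open sets: a name is `⟨p, q, r⟩`, where
`p` names the sequence, the sets `α (q i)` cover its union, and the members meeting `α (q i)` have
their indices in the finite set with canonical (binary) code `r i`. -/
def delta1 (ν : ℕ → X) (α : ℕ → Set X) : Rep (ℕ → Opens X) := fun s V =>
  LF α V ∧ (sigmaRep ν).seq (proj3 s 0) V ∧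
    (⋃ j, (V j : Set X)) ⊆ ⋃ i, α (proj3 s 1 i) ∧
    ∀ i, {j | ((V j : Set X) ∩ α (proj3 s 1 i)).Nonempty} ⊆ {j | (proj3 s 2 i).testBit j = true}

/-- The representation `δ₂`: the cover in the name is moreover exact. -/
def delta2 (ν : ℕ → X) (α : ℕ → Set X) : Rep (ℕ → Opens X) := fun s V =>
  delta1 ν α s V ∧ (⋃ j, (V j : Set X)) = ⋃ i, α (proj3 s 1 i)

/-- The distance between two sets, `∞` if one of them is empty. -/
noncomputable def setDist (S T : Set X) : ENNReal := ⨅ x ∈ S, ⨅ y ∈ T, edist x y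

/-- `(V, y)` is a Dugundji system for the nonempty closed set `A`, with coefficient `1 + ε`. -/
def IsDugundjiSystem (ν : ℕ → X) (ε : ℝ) (A : Closeds X) (V : ℕ → Opens X) (y : ℕ → X) : Prop :=
  (A : Set X).Nonempty ∧ LF (shiftNum (ballNum ν)) V ∧
    (⋃ i, (V i : Set X)) = (A : Set X)ᶜ ∧ (∀ i, y i ∈ A) ∧
    (∀ i, ∀ x ∈ V i, dist x (y i) ≤ (1 + ε) * Metric.infDist x (A : Set X)) ∧
    ∀ n : ℕ → ℕ, Tendsto (fun i => setDist (V (n i) : Set X) (A : Set X)) atTop (𝓝 0) →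
      Tendsto (fun i => Metric.ediam (V (n i) : Set X)) atTop (𝓝 0)

/-- The closed set `π((V, y)) = X \ ⋃ i, V i`. -/
def piSet (D : (ℕ → Opens X) × (ℕ → X)) : Closeds X := (⨆ i, D.1 i).compl

/-- The set `𝒟(X)` of Dugundji systems with coefficient `2`. -/
def systems (ν : ℕ → X) : Set ((ℕ → Opens X) × (ℕ → X)) :=
  {D | IsDugundjiSystem ν 1 (piSet D) D.1 D.2}

/-- The representation `δ₃` of Dugundji systems. -/
def delta3 (ν : ℕ → X) : Rep ((ℕ → Opens X) × (ℕ → X)) := fun s D =>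
  D ∈ systems ν ∧ delta2 ν (shiftNum (ballNum ν)) (proj2 s 0) D.1 ∧
    (cauchyRep ν).seq (proj2 s 1) D.2

/-- The representation `δ₄` of nonempty closed sets by names of Dugundji systems. -/
def delta4 (ν : ℕ → X) : Rep (Closeds X) := fun s A =>
  ∃ D ∈ systems ν, piSet D = A ∧ delta3 ν s D

/-- The representation `δ₈` of nonempty closed sets: a name of `A` is `⟨p, q⟩`, where `p` is a
`δ_range`-name of a closed set between the boundary of `A` and `A`, and `q` names `A` as a
closed set. -/
def delta8 (ν : ℕ → X) : Rep (Closeds X) := fun s A =>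
  (A : Set X).Nonempty ∧
    (∃ B : Closeds X, frontier (A : Set X) ⊆ B ∧ (B : Set X) ⊆ A ∧ rangeRep ν (proj2 s 0) B) ∧
    piRep ν (proj2 s 1) A

/-- The closed sets other than `∅` and `X`. -/
def properClosed (X : Type*) [MetricSpace X] : Set (Closeds X) :=
  {A | (A : Set X) ≠ ∅ ∧ (A : Set X) ≠ Set.univ}

end Metric

end Dugundji

/-!
Call a ball small if four times its radius is less than the distance of its center to `A`. A
`δ_dist^>`-name of `A` enumerates the small balls, and these cover `X ∖ A`. To make this cover
locally finite, remove from the `n`-th ball all points that lie at depth at least `2⁻ⁿ` in an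
earlier ball. A ball that lies at depth more than `2⁻ᴺ` in one of the first `N` balls then meets
only refined sets with index below `N`, and such balls with their bounds `N` can be enumerated. The
distance from a refined set to `A` is at least its diameter, and a point of the given dense sequence
of `A` that is near enough to the center of a small ball is found by a search: this is a Dugundji
system.

Conversely, the points `y i` of a Dugundji system for `A` accumulate at every frontier point of `A`:
near a frontier point there are points of `X ∖ A`, each in some `V i`, and `y i` is at most twice as
far from such a point as `A` is. Hence the closure of `{y i}` lies between `∂A` and `A`, while the
exact cover of `⋃ i, V i` in a `δ₄`-name is a name of the complement of `A`.
-/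

namespace Dugundji

section Words

theorem word_length (p : Baire) (k : ℕ) : (word p k).length = k := by simp [word]

theorem getD_word (p : Baire) {i k : ℕ} (h : i < k) : (word p k).getD i 0 = p i := by
  simp [word, h]

theorem word_getD (w : List ℕ) : word (fun i => w.getD i 0) w.length = w :=
  List.ext_getElem (word_length _ _) fun i _ hi => by simp [word, hi]

theorem word_congr {p q : Baire} {k : ℕ} (h : ∀ i < k, p i = q i) : word p k = word q k :=
  List.map_congr_left fun i hi => h i (List.mem_range.1 hi)

theorem word_succ (p : Baire) (k : ℕ) : word p (k + 1) = word p k ++ [p k] := by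
  simp [word, List.range_succ]

theorem word_prefix_word (p : Baire) {j k : ℕ} (h : j ≤ k) : word p j <+: word p k := by
  induction h with
  | refl => exact List.prefix_rfl
  | step _ ih => exact ih.trans (word_succ p _ ▸ List.prefix_append _ _)

theorem word_take (p : Baire) {j k : ℕ} (h : j ≤ k) : (word p k).take j = word p j := by
  simpa [word_length] using (List.prefix_iff_eq_take.1 (word_prefix_word p h)).symm

theorem exists_eq_word_of_isPrefix {u v : List ℕ} (h : u <+: v) :
    ∃ p j k, j ≤ k ∧ u = word p j ∧ v = word p k := by
  refine ⟨fun i => v.getD i 0, u.length, v.length, h.length_le, ?_, (word_getD v).symm⟩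
  rw [← word_take _ h.length_le, word_getD]
  exact List.prefix_iff_eq_take.1 h

theorem eq_of_word_eq {p q : Baire} (h : ∀ n, word p n = word q n) : p = q := by
  funext i
  rw [← getD_word p i.lt_succ_self, h, getD_word q i.lt_succ_self]

theorem primrec_word {α : Type*} [Primcodable α] {f : α → ℕ → ℕ} (hf : Primrec₂ f) {l : α → ℕ}
    (hl : Primrec l) : Primrec fun a => word (f a) (l a) :=
  Primrec.list_map (Primrec.list_range.comp hl) hf

/-- The pair `⟨p, q⟩` of two names; its components are read off by `proj2`. -/
def pairName (p q : Baire) : Baire := fun n => if n % 2 = 0 then p (n / 2) else q (n / 2)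

@[simp]
theorem proj2_pairName_zero (p q : Baire) : proj2 (pairName p q) 0 = p := by
  funext n
  simp [proj2, pairName]

@[simp]
theorem proj2_pairName_one (p q : Baire) : proj2 (pairName p q) 1 = q := by
  funext n
  simp [proj2, pairName, Nat.add_mod, show (2 * n + 1) / 2 = n by lia]

/-- The part of the name `⟨p, q⟩` that is known once prefixes of `p` and `q` are. -/
def pairWord (u v : List ℕ) : List ℕ :=
  word (pairName (fun i => u.getD i 0) fun i => v.getD i 0) (2 * min u.length v.length)

theorem pairWord_word (p q : Baire) (j k : ℕ) :
    pairWord (word p j) (word q k) = word (pairName p q) (2 * min j k) := by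
  rw [pairWord, word_length, word_length]
  refine word_congr fun i hi => ?_
  simp only [pairName, getD_word p (show i / 2 < j by lia), getD_word q (show i / 2 < k by lia)]

theorem pairWord_mono {u u' v v' : List ℕ} (hu : u <+: u') (hv : v <+: v') :
    pairWord u v <+: pairWord u' v' := by
  obtain ⟨p, j, k, hjk, rfl, rfl⟩ := exists_eq_word_of_isPrefix hu
  obtain ⟨q, m, n, hmn, rfl, rfl⟩ := exists_eq_word_of_isPrefix hv
  simp only [pairWord_word]
  exact word_prefix_word _ (by lia)

theorem primrec_pairWord : Primrec₂ pairWord := by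
  have entry {f : (List ℕ × List ℕ) × ℕ → List ℕ} (hf : Primrec f) :
      Primrec fun a => (f a).getD (a.2 / 2) 0 :=
    (Primrec.list_getD 0).comp hf (Primrec.nat_div.comp .snd (.const 2))
  refine primrec_word (f := fun a : List ℕ × List ℕ => pairName _ _)
    (Primrec.ite ?_ (entry (Primrec.fst.comp .fst)) (entry (Primrec.snd.comp .fst))) ?_
  · exact Primrec.eq.comp (Primrec.nat_mod.comp .snd (.const 2)) (.const 0)
  · exact Primrec.nat_mul.comp (.const 2) (Primrec.nat_min.comp
      (Primrec.list_length.comp .fst) (Primrec.list_length.comp .snd))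

end Words

section ComputableMap

/-- A type each of whose elements has a distinguished name. Computability on such a type refers
to these names, so that a representation `δ` is studied on the type `δ.Name` of pairs of a point and
one of its names. -/
class Named (P : Type*) where
  /-- The distinguished name. -/
  name : P → Baire

open Named

instance : Named Baire := ⟨id⟩

instance : Named ℕ := ⟨fun n _ => n⟩

instance {P Q : Type*} [Named P] [Named Q] : Named (P × Q) :=
  ⟨fun x => pairName (name x.1) (name x.2)⟩

variable {P Q R : Type*} [Named P] [Named Q] [Named R]

/-- The map `f` is computable on names, uniformly: one primitive recursive prefix-monotone word
function writes the name of `f x` while reading the name of `x`. Primitive recursion is no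
restriction, as output may be delayed. -/
@[fun_prop]
def ComputableMap (f : P → Q) : Prop :=
  ∃ h : List ℕ → List ℕ, Primrec h ∧ (∀ u v, u <+: v → h u <+: h v) ∧
    ∀ x n, ∃ k, word (name (f x)) n <+: h (word (name x) k)

theorem prefix_word_of_forall_exists_isPrefix {h : List ℕ → List ℕ}
    (hmono : ∀ u v, u <+: v → h u <+: h v) {p q : Baire}
    (hlim : ∀ n, ∃ k, word q n <+: h (word p k)) (k : ℕ) :
    h (word p k) <+: word q (h (word p k)).length := by
  obtain ⟨j, hj⟩ := hlim (h (word p k)).length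
  refine List.prefix_of_prefix_length_le (hmono _ _ (word_prefix_word p (le_max_left k j)))
    (hj.trans (hmono _ _ (word_prefix_word p (le_max_right k j)))) (word_length _ _).ge

theorem eq_of_forall_exists_isPrefix {h : List ℕ → List ℕ} (hmono : ∀ u v, u <+: v → h u <+: h v)
    {p q q' : Baire} (hq : ∀ n, ∃ k, word q n <+: h (word p k))
    (hq' : ∀ n, ∃ k, word q' n <+: h (word p k)) : q = q' := by
  refine eq_of_word_eq fun n => ?_
  obtain ⟨k, hk⟩ := hq n
  have hn : n ≤ (h (word p k)).length := word_length q n ▸ hk.length_le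
  have := List.prefix_of_prefix_length_le
    (hk.trans (prefix_word_of_forall_exists_isPrefix hmono hq' k)) (word_prefix_word q' hn)
    (by simp only [word_length, le_refl])
  exact this.eq_of_length (by simp only [word_length])

theorem ComputableMap.exists_isComputable {G : P → Baire} (hG : ComputableMap G) :
    ∃ F : Baire →. Baire, IsComputable F ∧ ∀ x, G x ∈ F (name x) := by
  obtain ⟨h, hh, hmono, hlim⟩ := hG
  let F : Baire →. Baire := fun p => ⟨∃ q, ∀ n, ∃ k, word q n <+: h (word p k), Exists.choose⟩
  have mem_iff (p q : Baire) : q ∈ F p ↔ ∀ n, ∃ k, word q n <+: h (word p k) :=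
    ⟨fun ⟨hd, hq⟩ => hq ▸ hd.choose_spec, fun hq =>
      have hd : ∃ q, ∀ n, ∃ k, word q n <+: h (word p k) := ⟨q, hq⟩
      ⟨hd, eq_of_forall_exists_isPrefix hmono hd.choose_spec hq⟩⟩
  exact ⟨F, ⟨h, hh.to_comp, hmono, mem_iff⟩, fun x => (mem_iff _ _).2 (hlim x)⟩

/-- The points of a represented set together with one of their names, which is the distinguished
one. -/
def Rep.Name {Y : Type*} (δ : Rep Y) : Type _ := {x : Baire × Y // δ x.1 x.2}

instance {Y : Type*} (δ : Rep Y) : Named δ.Name := ⟨fun x => x.1.1⟩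

theorem Rep.Reducible.of_computableMap {Y : Type*} {δ δ' : Rep Y} {G : δ.Name → Baire}
    (hG : ComputableMap G) (h : ∀ x : δ.Name, δ' (G x) x.1.2) : δ.Reducible δ' := by
  obtain ⟨F, hF, hGF⟩ := hG.exists_isComputable
  exact ⟨F, hF, fun p y hy => ⟨_, hGF ⟨(p, y), hy⟩, h ⟨(p, y), hy⟩⟩⟩

theorem Rep.Reducible.restrict {Y : Type*} {δ δ' : Rep Y} (h : δ.Reducible δ') (S : Set Y) :
    (δ.restrict S).Reducible (δ'.restrict S) := by
  obtain ⟨F, hF, hδ⟩ := h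
  exact ⟨F, hF, fun p y hy => (hδ p y hy.2).imp fun q hq => ⟨hq.1, hy.1, hq.2⟩⟩

theorem computableMap_of_name_eq {f : P → Q} (h : ∀ x, name (f x) = name x) : ComputableMap f :=
  ⟨id, .id, fun _ _ => id, fun x n => ⟨n, h x ▸ List.prefix_rfl⟩⟩

@[fun_prop]
theorem ComputableMap.id : ComputableMap fun x : P => x := computableMap_of_name_eq fun _ => rfl

@[fun_prop]
theorem ComputableMap.comp {g : Q → R} {f : P → Q} (hg : ComputableMap g) (hf : ComputableMap f) :
    ComputableMap fun x => g (f x) := by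
  obtain ⟨hg, hg_prim, hg_mono, hg_lim⟩ := hg
  obtain ⟨hf, hf_prim, hf_mono, hf_lim⟩ := hf
  refine ⟨hg ∘ hf, hg_prim.comp hf_prim, fun u v huv => hg_mono _ _ (hf_mono _ _ huv),
    fun x n => ?_⟩
  obtain ⟨j, hj⟩ := hg_lim (f x) n
  obtain ⟨k, hk⟩ := hf_lim x j
  exact ⟨k, hj.trans (hg_mono _ _ hk)⟩

@[fun_prop]
theorem ComputableMap.prodMk {f : P → Q} {g : P → R} (hf : ComputableMap f)
    (hg : ComputableMap g) : ComputableMap fun x => (f x, g x) := by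
  obtain ⟨hf, hf_prim, hf_mono, hf_lim⟩ := hf
  obtain ⟨hg, hg_prim, hg_mono, hg_lim⟩ := hg
  refine ⟨fun w => pairWord (hf w) (hg w), primrec_pairWord.comp hf_prim hg_prim,
    fun u v huv => pairWord_mono (hf_mono _ _ huv) (hg_mono _ _ huv), fun x n => ?_⟩
  obtain ⟨j, hj⟩ := hf_lim x n
  obtain ⟨k, hk⟩ := hg_lim x n
  refine ⟨max j k, .trans ?_ (pairWord_mono
    (hj.trans (hf_mono _ _ (word_prefix_word _ (le_max_left j k))))
    (hk.trans (hg_mono _ _ (word_prefix_word _ (le_max_right j k)))))⟩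
  rw [pairWord_word]
  exact word_prefix_word _ (by lia)

theorem ComputableMap.of_entries {f : P → Q} (F : Baire → Baire) (hF : ∀ x, name (f x) = F (name x))
    {g : List ℕ → ℕ → ℕ} (hg : Primrec₂ g) {l : List ℕ → ℕ} (hl : Primrec l)
    (hl_mono : ∀ p, Monotone fun k => l (word p k)) (hl_lim : ∀ p n, ∃ k, n ≤ l (word p k))
    (hgF : ∀ p k, ∀ i < l (word p k), g (word p k) i = F p i) : ComputableMap f := by
  have eq_word (p : Baire) (k : ℕ) :
      word (g (word p k)) (l (word p k)) = word (F p) (l (word p k)) := word_congr (hgF p k)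
  refine ⟨fun w => word (g w) (l w), primrec_word hg hl, fun u v huv => ?_, fun x n => ?_⟩
  · obtain ⟨p, j, k, hjk, rfl, rfl⟩ := exists_eq_word_of_isPrefix huv
    simp only [eq_word]
    exact word_prefix_word _ (hl_mono p hjk)
  · obtain ⟨k, hk⟩ := hl_lim (name x) n
    exact ⟨k, by simpa only [hF, eq_word] using word_prefix_word _ hk⟩

@[fun_prop]
theorem ComputableMap.fst : ComputableMap (Prod.fst : P × Q → P) := by
  refine .of_entries (fun p => proj2 p 0) (fun x => (proj2_pairName_zero _ _).symm)
    (g := fun w i => w.getD (2 * i) 0)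
    ((Primrec.list_getD 0).comp .fst (Primrec.nat_mul.comp (.const 2) .snd))
    (l := fun w => w.length / 2) (Primrec.nat_div.comp .list_length (.const 2))
    (fun p j k h => ?_) (fun p n => ⟨2 * n, by simp [word_length]⟩) (fun p k i hi => ?_)
  · simpa only [word_length] using Nat.div_le_div_right h
  · rw [word_length] at hi
    exact getD_word p (by lia)

@[fun_prop]
theorem ComputableMap.snd : ComputableMap (Prod.snd : P × Q → Q) := by
  refine .of_entries (fun p => proj2 p 1) (fun x => (proj2_pairName_one _ _).symm)
    (g := fun w i => w.getD (2 * i + 1) 0) ((Primrec.list_getD 0).comp .fst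
      (Primrec.succ.comp (Primrec.nat_mul.comp (.const 2) .snd)))
    (l := fun w => w.length / 2) (Primrec.nat_div.comp .list_length (.const 2))
    (fun p j k h => ?_) (fun p n => ⟨2 * n, by simp [word_length]⟩) (fun p k i hi => ?_)
  · simpa only [word_length] using Nat.div_le_div_right h
  · rw [word_length] at hi
    exact getD_word p (by lia)

@[fun_prop]
theorem ComputableMap.const (n : ℕ) : ComputableMap fun _ : P => n :=
  .of_entries (fun _ _ => n) (fun _ => rfl) (g := fun _ _ => n) (.const n) .list_length
    (fun p j k h => by simpa only [word_length] using h)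
    (fun p n => ⟨n, (word_length p n).ge⟩) (fun _ _ _ _ => rfl)

theorem ComputableMap.of_primrec₂ {f : ℕ → ℕ → ℕ} (hf : Primrec₂ f) :
    ComputableMap fun x : ℕ × ℕ => f x.1 x.2 := by
  refine .of_entries (fun p _ => f (p 0) (p 1)) (fun x => rfl)
    (g := fun w _ => f (w.getD 0 0) (w.getD 1 0))
    (hf.comp ((Primrec.list_getD 0).comp .fst (.const 0))
      ((Primrec.list_getD 0).comp .fst (.const 1)))
    (l := fun w => w.length / 2) (Primrec.nat_div.comp .list_length (.const 2))
    (fun p j k h => ?_) (fun p n => ⟨2 * n, by simp [word_length]⟩) (fun p k _ hi => ?_)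
  · simpa only [word_length] using Nat.div_le_div_right h
  · rw [word_length] at hi
    rw [getD_word p (show 0 < k by lia), getD_word p (show 1 < k by lia)]

theorem ComputableMap.of_primrec {f : ℕ → ℕ} (hf : Primrec f) : ComputableMap f :=
  (of_primrec₂ (f := fun a _ => f a) (hf.comp .fst)).comp (.prodMk .id (.const 0))

theorem ComputableMap.eval : ComputableMap fun x : Baire × ℕ => x.1 x.2 := by
  let l (w : List ℕ) : ℕ := if 2 * w.getD 1 0 + 2 ≤ w.length then w.length else 0
  have l_word (p : Baire) (k : ℕ) : l (word p k) = if 2 * p 1 + 2 ≤ k then k else 0 := by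
    rcases lt_or_ge 1 k with hk | hk
    · simp only [l, word_length, getD_word p hk]
    · simp only [l, word_length]
      rw [if_neg (by lia), if_neg (by lia)]
  have hl : Primrec l := Primrec.ite (Primrec.nat_le.comp (Primrec.nat_add.comp
    (Primrec.nat_mul.comp (.const 2) ((Primrec.list_getD 0).comp .id (.const 1))) (.const 2))
    .list_length) .list_length (.const 0)
  have hg : Primrec₂ fun (w : List ℕ) (_ : ℕ) => w.getD (2 * w.getD 1 0) 0 :=
    (Primrec.list_getD 0).comp .fst (Primrec.nat_mul.comp (.const 2)
      ((Primrec.list_getD 0).comp .fst (.const 1)))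
  refine .of_entries (fun p _ => p (2 * p 1)) (fun x => ?_) hg hl (fun p j k h => ?_)
    (fun p n => ⟨max n (2 * p 1 + 2), ?_⟩) (fun p k _ hi => ?_)
  · funext
    simp [name, pairName]
  · simp only [l_word]
    split_ifs <;> lia
  · rw [l_word, if_pos (le_max_right _ _)]
    exact le_max_left _ _
  · rw [l_word] at hi
    split_ifs at hi with h
    · rw [getD_word p (show 1 < k by lia), getD_word p (by lia)]
    · exact absurd hi (Nat.not_lt_zero _)

end ComputableMap

section Semidecidable

open Named

variable {P Q : Type*} [Named P] [Named Q]

/-- The predicate `R` is semidecidable from names, uniformly: `R x` holds if and only if some prefix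
of the name of `x` passes a primitive recursive test. The test is monotone, so that it is passed by
all longer prefixes as well. -/
@[fun_prop]
def Semidecidable (R : P → Prop) : Prop :=
  ∃ c : List ℕ → Prop, PrimrecPred c ∧ (∀ u v, u <+: v → c u → c v) ∧
    ∀ x, R x ↔ ∃ k, c (word (name x) k)

theorem Semidecidable.of_iff {R S : P → Prop} (hR : Semidecidable R) (h : ∀ x, S x ↔ R x) :
    Semidecidable S := by
  rwa [funext fun x => propext (h x)]

@[fun_prop]
theorem Semidecidable.comp {R : Q → Prop} (hR : Semidecidable R) {f : P → Q}
    (hf : ComputableMap f) : Semidecidable fun x => R (f x) := by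
  obtain ⟨c, hc, hc_mono, hR⟩ := hR
  obtain ⟨h, hh, hmono, hlim⟩ := hf
  refine ⟨fun w => c (h w), hc.comp hh, fun u v huv => hc_mono _ _ (hmono _ _ huv), fun x => ?_⟩
  refine (hR _).trans ⟨fun ⟨n, hn⟩ => ?_, fun ⟨k, hk⟩ => ?_⟩
  · obtain ⟨k, hk⟩ := hlim x n
    exact ⟨k, hc_mono _ _ hk hn⟩
  · exact ⟨_, hc_mono _ _ (prefix_word_of_forall_exists_isPrefix hmono (hlim x) k) hk⟩

@[fun_prop]
theorem Semidecidable.and {R S : P → Prop} (hR : Semidecidable R) (hS : Semidecidable S) :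
    Semidecidable fun x => R x ∧ S x := by
  obtain ⟨c, hc, hc_mono, hR⟩ := hR
  obtain ⟨d, hd, hd_mono, hS⟩ := hS
  refine ⟨fun w => c w ∧ d w, hc.and hd, fun u v huv => And.imp (hc_mono _ _ huv) (hd_mono _ _ huv),
    fun x => ?_⟩
  simp only [hR, hS]
  refine ⟨fun ⟨⟨j, hj⟩, ⟨k, hk⟩⟩ => ⟨max j k, ?_, ?_⟩, fun ⟨k, hj, hk⟩ => ⟨⟨k, hj⟩, ⟨k, hk⟩⟩⟩
  · exact hc_mono _ _ (word_prefix_word _ (le_max_left j k)) hj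
  · exact hd_mono _ _ (word_prefix_word _ (le_max_right j k)) hk

@[fun_prop]
theorem Semidecidable.or {R S : P → Prop} (hR : Semidecidable R) (hS : Semidecidable S) :
    Semidecidable fun x => R x ∨ S x := by
  obtain ⟨c, hc, hc_mono, hR⟩ := hR
  obtain ⟨d, hd, hd_mono, hS⟩ := hS
  refine ⟨fun w => c w ∨ d w, hc.or hd, fun u v huv => Or.imp (hc_mono _ _ huv) (hd_mono _ _ huv),
    fun x => ?_⟩
  simp only [hR, hS, exists_or]

theorem Semidecidable.exists_primrecRel {R : P × ℕ → Prop} (hR : Semidecidable R) :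
    ∃ d : List ℕ → ℕ → Prop, PrimrecRel d ∧ (∀ u v n, u <+: v → d u n → d v n) ∧
      ∀ x n, R (x, n) ↔ ∃ k, d (word (name x) k) n := by
  obtain ⟨c, hc, hc_mono, hR⟩ := hR
  refine ⟨fun w n => c (pairWord w (word (fun _ => n) w.length)), ?_, fun u v n huv => ?_,
    fun x n => ?_⟩
  · exact hc.comp (primrec_pairWord.comp .fst (primrec_word (f := fun (a : List ℕ × ℕ) _ => a.2)
      (Primrec.snd.comp .fst) (Primrec.list_length.comp .fst)))
  · exact hc_mono _ _ (pairWord_mono huv (word_prefix_word _ huv.length_le))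
  · simp only [hR, word_length, pairWord_word, min_self]
    exact ⟨fun ⟨k, hk⟩ => ⟨k, hc_mono _ _ (word_prefix_word _ (by lia)) hk⟩,
      fun ⟨k, hk⟩ => ⟨2 * k, hk⟩⟩

theorem Semidecidable.of_primrecRel {d : List ℕ → ℕ → Prop} (hd : PrimrecRel d)
    (hd_mono : ∀ u v n, u <+: v → d u n → d v n) {R : P × ℕ → Prop}
    (h : ∀ x n, R (x, n) ↔ ∃ k, d (word (name x) k) n) : Semidecidable R := by
  let c (w : List ℕ) : Prop :=
    2 ≤ w.length ∧ d (word (fun i => w.getD (2 * i) 0) (w.length / 2)) (w.getD 1 0)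
  have c_word (p q : Baire) (k : ℕ) :
      c (word (pairName p q) k) ↔ 2 ≤ k ∧ d (word p (k / 2)) (q 0) := by
    simp only [c, word_length]
    refine and_congr_right fun hk => ?_
    rw [getD_word _ (show 1 < k by lia), word_congr fun i hi => getD_word _ (by lia)]
    simp [pairName]
  refine ⟨c, ?_, fun u v huv => ?_, fun ⟨x, n⟩ => (h x n).trans ?_⟩
  · refine (Primrec.nat_le.comp (.const 2) .list_length).and (hd.comp (primrec_word ?_ ?_) ?_)
    · exact (Primrec.list_getD 0).comp .fst (Primrec.nat_mul.comp (.const 2) .snd)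
    · exact Primrec.nat_div.comp .list_length (.const 2)
    · exact (Primrec.list_getD 0).comp .id (.const 1)
  · obtain ⟨p, j, k, hjk, rfl, rfl⟩ := exists_eq_word_of_isPrefix huv
    rw [show p = pairName (proj2 p 0) (proj2 p 1) by
      funext i; simp only [pairName, proj2]; split_ifs <;> congr 1 <;> lia]
    simp only [c_word]
    exact And.imp hjk.trans' (hd_mono _ _ _ (word_prefix_word _ (by lia)))
  · simp only [name, c_word]
    exact ⟨fun ⟨k, hk⟩ => ⟨2 * (k + 1), by lia, hd_mono _ _ _ (word_prefix_word _ (by lia)) hk⟩,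
      fun ⟨k, hk⟩ => ⟨_, hk.2⟩⟩

theorem Semidecidable.exists_nat {R : P × ℕ → Prop} (hR : Semidecidable R) :
    Semidecidable fun x => ∃ n, R (x, n) := by
  obtain ⟨d, hd, hd_mono, hR⟩ := hR.exists_primrecRel
  refine ⟨fun w => ∃ n < w.length, d w n, ?_, fun u v huv => ?_, fun x => ?_⟩
  · have hd' : PrimrecRel fun n w => d w n := hd.comp .snd .fst
    exact (hd'.exists_mem_list.comp (Primrec.list_range.comp .list_length) .id).of_eq
      fun w => by simp only [List.mem_range, id]
  · exact fun ⟨n, hn, h⟩ => ⟨n, hn.trans_le huv.length_le, hd_mono _ _ _ huv h⟩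
  · simp only [hR, word_length]
    exact ⟨fun ⟨n, k, h⟩ => ⟨max (n + 1) k, n, by lia,
      hd_mono _ _ _ (word_prefix_word _ (le_max_right _ _)) h⟩, fun ⟨k, n, _, h⟩ => ⟨n, k, h⟩⟩

@[fun_prop]
theorem Semidecidable.exists {R : P → ℕ → Prop} (hR : Semidecidable fun x : P × ℕ => R x.1 x.2) :
    Semidecidable fun x => ∃ n, R x n := hR.exists_nat

theorem exists_iff_eventually_of_monotone {D : ℕ → Prop} (h : Monotone D) :
    (∃ k, D k) ↔ ∀ᶠ k in atTop, D k :=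
  (exists_congr fun _ => ⟨fun hk _ hj => h hj hk, fun hk => hk _ le_rfl⟩).trans
    eventually_atTop.symm

theorem Semidecidable.forall_lt {R : P × ℕ → Prop} (hR : Semidecidable R) {b : P → ℕ}
    (hb : ComputableMap b) : Semidecidable fun x => ∀ n < b x, R (x, n) := by
  obtain ⟨d, hd, hd_mono, hR⟩ := hR.exists_primrecRel
  have h : Semidecidable fun x : P × ℕ => ∀ n < x.2, R (x.1, n) := by
    refine .of_primrecRel (d := fun w b => ∀ n < b, d w n) ?_
      (fun u v b huv h n hn => hd_mono _ _ _ huv (h n hn)) fun x b => ?_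
    · have hd' : PrimrecRel fun n w => d w n := hd.comp .snd .fst
      exact (hd'.forall_mem_list.comp (Primrec.list_range.comp .snd) .fst).of_eq
        fun a => by simp only [List.mem_range]
    · have monotone_d (n : ℕ) : Monotone fun k => d (word (name x) k) n :=
        fun j k hjk => hd_mono _ _ n (word_prefix_word _ hjk)
      have monotone_forall : Monotone fun k => ∀ n < b, d (word (name x) k) n :=
        fun j k hjk h n hn => monotone_d n hjk (h n hn)
      simp only [hR, exists_iff_eventually_of_monotone monotone_forall,
        exists_iff_eventually_of_monotone (monotone_d _)]
      exact (Set.finite_lt_nat b).eventually_all.symm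
  exact h.comp (f := fun x => (x, b x)) (by fun_prop)

theorem Semidecidable.of_primrecPred {c : ℕ → Prop} (hc : PrimrecPred c) : Semidecidable c := by
  refine ⟨fun w => w ≠ [] ∧ c (w.getD 0 0), ?_, ?_,
    fun n => ⟨fun h => ⟨1, ?_⟩, fun ⟨k, hk, h⟩ => ?_⟩⟩
  · exact (Primrec.eq.comp .id (.const [])).not.and
      (hc.comp ((Primrec.list_getD 0).comp .id (.const 0)))
  · rintro u v ⟨w, rfl⟩ ⟨hu, h⟩
    cases u with
    | nil => exact absurd rfl hu
    | cons => exact ⟨List.cons_ne_nil _ _, h⟩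
  · simpa [word, name]
  · rwa [getD_word _ (Nat.pos_of_ne_zero fun h => hk (by simp [word, h]))] at h

@[fun_prop]
theorem ComputableMap.pair {f g : P → ℕ} (hf : ComputableMap f) (hg : ComputableMap g) :
    ComputableMap fun x => Nat.pair (f x) (g x) :=
  (of_primrec₂ Primrec₂.natPair).comp (hf.prodMk hg)

@[fun_prop]
theorem ComputableMap.unpair {f : P → ℕ} (hf : ComputableMap f) :
    ComputableMap fun x => (f x).unpair :=
  (ComputableMap.prodMk (of_primrec (Primrec.fst.comp .unpair))
    (of_primrec (Primrec.snd.comp .unpair))).comp hf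

@[fun_prop]
theorem ComputableMap.add {f g : P → ℕ} (hf : ComputableMap f) (hg : ComputableMap g) :
    ComputableMap fun x => f x + g x :=
  (of_primrec₂ Primrec.nat_add).comp (hf.prodMk hg)

@[fun_prop]
theorem ComputableMap.sub {f g : P → ℕ} (hf : ComputableMap f) (hg : ComputableMap g) :
    ComputableMap fun x => f x - g x :=
  (of_primrec₂ Primrec.nat_sub).comp (hf.prodMk hg)

@[fun_prop]
theorem ComputableMap.mul {f g : P → ℕ} (hf : ComputableMap f) (hg : ComputableMap g) :
    ComputableMap fun x => f x * g x :=
  (of_primrec₂ Primrec.nat_mul).comp (hf.prodMk hg)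

@[fun_prop]
theorem ComputableMap.div {f g : P → ℕ} (hf : ComputableMap f) (hg : ComputableMap g) :
    ComputableMap fun x => f x / g x :=
  (of_primrec₂ Primrec.nat_div).comp (hf.prodMk hg)

@[fun_prop]
theorem ComputableMap.mod {f g : P → ℕ} (hf : ComputableMap f) (hg : ComputableMap g) :
    ComputableMap fun x => f x % g x :=
  (of_primrec₂ Primrec.nat_mod).comp (hf.prodMk hg)

@[fun_prop]
theorem ComputableMap.pow {f g : P → ℕ} (hf : ComputableMap f) (hg : ComputableMap g) :
    ComputableMap fun x => f x ^ g x :=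
  (of_primrec₂ (Primrec₂.unpaired'.1 Nat.Primrec.pow)).comp (hf.prodMk hg)

@[fun_prop]
protected theorem ComputableMap.name {f : P → Q} (hf : ComputableMap f) :
    ComputableMap fun x => name (f x) :=
  comp (computableMap_of_name_eq (f := name) fun _ => rfl) hf

@[fun_prop]
theorem ComputableMap.name_apply {f : P → Q} {g : P → ℕ} (hf : ComputableMap f)
    (hg : ComputableMap g) : ComputableMap fun x => name (f x) (g x) :=
  eval.comp (.prodMk (.name hf) hg)

theorem Semidecidable.of_primrecRel_nat {c : ℕ → ℕ → Prop} (hc : PrimrecRel c) {f g : P → ℕ}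
    (hf : ComputableMap f) (hg : ComputableMap g) : Semidecidable fun x => c (f x) (g x) := by
  have hpair : Semidecidable fun n : ℕ => c n.unpair.1 n.unpair.2 :=
    of_primrecPred (hc.comp (Primrec.fst.comp .unpair) (Primrec.snd.comp .unpair))
  simpa only [Nat.unpair_pair] using hpair.comp (hf.pair hg)

@[fun_prop]
theorem Semidecidable.lt {f g : P → ℕ} (hf : ComputableMap f) (hg : ComputableMap g) :
    Semidecidable fun x => f x < g x := of_primrecRel_nat Primrec.nat_lt hf hg

@[fun_prop]
theorem Semidecidable.eq {f g : P → ℕ} (hf : ComputableMap f) (hg : ComputableMap g) :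
    Semidecidable fun x => f x = g x := of_primrecRel_nat Primrec.eq hf hg

theorem Semidecidable.exists_decidable {R : P → Prop} (hR : Semidecidable R) :
    ∃ D : P × ℕ → Prop, Semidecidable D ∧ (Semidecidable fun x => ¬D x) ∧
      ∀ x, R x ↔ ∃ k, D (x, k) := by
  obtain ⟨c, hc, _, hR⟩ := hR
  have take_eq {u v : List ℕ} {k : ℕ} (huv : u <+: v) (hk : k ≤ u.length) :
      v.take k = u.take k := by
    obtain ⟨p, i, j, hij, rfl, rfl⟩ := exists_eq_word_of_isPrefix huv
    rw [word_length] at hk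
    rw [word_take p hk, word_take p (hk.trans hij)]
  have of_isPrefix {c : List ℕ → Prop} (hc : PrimrecPred c) :
      Semidecidable fun x : P × ℕ => c (word (name x.1) x.2) := by
    refine .of_primrecRel (d := fun w k => k ≤ w.length ∧ c (w.take k)) ?_ ?_ fun x n => ?_
    · exact (Primrec.nat_le.comp .snd (Primrec.list_length.comp .fst)).and
        (hc.comp (Primrec.list_take.comp .snd .fst))
    · exact fun u v k huv ⟨hk, h⟩ => ⟨hk.trans huv.length_le, take_eq huv hk ▸ h⟩
    · refine ⟨fun h => ⟨n, (word_length _ n).ge, ?_⟩, fun ⟨k, hk, h⟩ => ?_⟩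
      · rwa [word_take _ le_rfl]
      · rw [word_length] at hk
        rwa [word_take _ hk] at h
  exact ⟨_, of_isPrefix hc, of_isPrefix hc.not, hR⟩

end Semidecidable

section Search

open Named

theorem getD_eq_of_isPrefix {u v : List ℕ} (h : u <+: v) {i : ℕ} (hi : i < u.length) :
    v.getD i 0 = u.getD i 0 := by
  obtain ⟨p, j, k, hjk, rfl, rfl⟩ := exists_eq_word_of_isPrefix h
  rw [word_length] at hi
  rw [getD_word p hi, getD_word p (hi.trans_le hjk)]

theorem exists_limit_of_isPrefix {o : ℕ → List ℕ} (ho : ∀ j k, j ≤ k → o j <+: o k)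
    (hlen : ∀ n, ∃ k, n ≤ (o k).length) : ∃ q : Baire, ∀ n, ∃ k, word q n <+: o k := by
  choose κ hκ using hlen
  refine ⟨fun i => (o (κ (i + 1))).getD i 0, fun n => ⟨κ n, ?_⟩⟩
  have agree (i : ℕ) (hi : i < n) : (o (κ (i + 1))).getD i 0 = (o (κ n)).getD i 0 := by
    rw [← getD_eq_of_isPrefix (ho _ _ (le_max_left _ (κ n))) (hκ (i + 1)),
      ← getD_eq_of_isPrefix (ho _ _ (le_max_right (κ (i + 1)) _)) (hi.trans_le (hκ n))]
  rw [word_congr agree]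
  exact (word_prefix_word _ (hκ n)).trans (word_getD _ ▸ List.prefix_rfl)

/-- The sequence of answers to the queries `0, 1, …` found by the test `d` while reading the word
`w`. After reading the `t`-th entry, the first component of `t` as a pair is tried as an answer to
the first open query, so that each answer is tried infinitely often. -/
def searchWord (d : List ℕ → ℕ → Bool) (w : List ℕ) : List ℕ :=
  (w.foldl (fun s a => (s.1 ++ [a],
    if d (s.1 ++ [a]) (Nat.pair s.2.length s.1.length.unpair.1) then
      s.2 ++ [s.1.length.unpair.1] else s.2)) ([], [])).2

variable {d : List ℕ → ℕ → Bool}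

theorem searchWord_concat (w : List ℕ) (a : ℕ) :
    searchWord d (w ++ [a]) =
      if d (w ++ [a]) (Nat.pair (searchWord d w).length w.length.unpair.1) then
        searchWord d w ++ [w.length.unpair.1] else searchWord d w := by
  have fst_foldl (f : List ℕ → List ℕ → ℕ → List ℕ) (w : List ℕ) :
      (w.foldl (fun s a => (s.1 ++ [a], f s.1 s.2 a)) (([], []) : List ℕ × List ℕ)).1 = w := by
    induction w using List.reverseRecOn with
    | nil => rfl
    | append_singleton w a ih => rw [List.foldl_concat, ih]
  rw [searchWord, List.foldl_concat]
  simp only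
  rw [fst_foldl fun u o a => if d (u ++ [a]) (Nat.pair o.length u.length.unpair.1) then
    o ++ [u.length.unpair.1] else o]
  rfl

theorem searchWord_mono {u v : List ℕ} (h : u <+: v) : searchWord d u <+: searchWord d v := by
  obtain ⟨w, rfl⟩ := h
  induction w using List.reverseRecOn with
  | nil => rw [List.append_nil]
  | append_singleton w a ih =>
    refine ih.trans ?_
    rw [← List.append_assoc, searchWord_concat]
    split_ifs
    · exact List.prefix_append _ _
    · exact List.prefix_rfl

theorem primrec_searchWord (hd : Primrec₂ d) : Primrec (searchWord d) := by
  have prim_read : Primrec fun a : List ℕ × (List ℕ × List ℕ) × ℕ => a.2.1.1 :=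
    Primrec.fst.comp (Primrec.fst.comp .snd)
  have prim_out : Primrec fun a : List ℕ × (List ℕ × List ℕ) × ℕ => a.2.1.2 :=
    Primrec.snd.comp (Primrec.fst.comp .snd)
  have prim_next := Primrec.list_concat.comp prim_read (Primrec.snd.comp .snd)
  have prim_guess := Primrec.fst.comp (Primrec.unpair.comp (Primrec.list_length.comp prim_read))
  have prim_query :=
    hd.comp prim_next (Primrec₂.natPair.comp (Primrec.list_length.comp prim_out) prim_guess)
  have prim_step := prim_next.pair (Primrec.ite (Primrec.eq.comp prim_query (.const true))
    (Primrec.list_concat.comp prim_out prim_guess) prim_out)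
  exact Primrec.snd.comp (Primrec.list_foldl .id (.const ([], [])) prim_step.to₂)

theorem exists_of_lt_length_searchWord (p : Baire) (k : ℕ) {i : ℕ}
    (hi : i < (searchWord d (word p k)).length) :
    ∃ j, d (word p j) (Nat.pair i ((searchWord d (word p k)).getD i 0)) := by
  induction k with
  | zero => exact absurd hi (Nat.not_lt_zero _)
  | succ k ih =>
    rw [word_succ, searchWord_concat, ← word_succ] at hi ⊢
    split_ifs at hi ⊢ with h
    · rcases (Nat.lt_succ_iff_lt_or_eq.1 (List.length_append ▸ hi)) with hlt | rfl
      · rw [List.getD_append _ _ _ _ hlt]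
        exact ih hlt
      · exact ⟨k + 1, by simpa [word_length] using h⟩
    · exact ih hi

theorem exists_le_length_searchWord (hd : ∀ u v n, u <+: v → d u n → d v n) {p : Baire}
    (h : ∀ n, ∃ m j, d (word p j) (Nat.pair n m)) (n : ℕ) :
    ∃ k, n ≤ (searchWord d (word p k)).length := by
  induction n with
  | zero => exact ⟨0, Nat.zero_le _⟩
  | succ n ih =>
    obtain ⟨k, hk⟩ := ih
    obtain ⟨m, j, hj⟩ := h n
    let t := Nat.pair m (max j k)
    have ht : max j k ≤ t := Nat.right_le_pair _ _
    have hn : n ≤ (searchWord d (word p t)).length := hk.trans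
      (searchWord_mono (word_prefix_word p ((le_max_right _ _).trans ht))).length_le
    rcases hn.lt_or_eq with hlt | heq
    · exact ⟨t, hlt⟩
    · have found : d (word p (t + 1)) (Nat.pair n m) :=
        hd _ _ _ (word_prefix_word p (((le_max_left _ _).trans ht).trans t.le_succ)) hj
      refine ⟨t + 1, ?_⟩
      rw [word_succ, searchWord_concat, ← word_succ, ← heq, word_length, Nat.unpair_pair,
        if_pos found, List.length_append, ← heq, List.length_singleton]

variable {P Q : Type*} [Named P] [Named Q]

theorem Semidecidable.exists_search {R : (P × ℕ) × ℕ → Prop} (hR : Semidecidable R)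
    (h : ∀ x n, ∃ m, R ((x, n), m)) :
    ∃ G : P → Baire, ComputableMap G ∧ ∀ x n, R ((x, n), G x n) := by
  have hR' : Semidecidable fun x : P × ℕ => R ((x.1, x.2.unpair.1), x.2.unpair.2) := by fun_prop
  obtain ⟨d, ⟨dec, hd⟩, hd_mono, hR'⟩ := hR'.exists_primrecRel
  have (u : List ℕ) (n : ℕ) : Decidable (d u n) := dec (u, n)
  let o (x : P) (k : ℕ) : List ℕ := searchWord (fun u n => decide (d u n)) (word (name x) k)
  have hR_iff (x : P) (n m : ℕ) : R ((x, n), m) ↔ ∃ k, d (word (name x) k) (Nat.pair n m) := by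
    simpa only [Nat.unpair_pair] using hR' x (Nat.pair n m)
  have hlim (x : P) : ∃ q : Baire, ∀ n, ∃ k, word q n <+: o x k :=
    exists_limit_of_isPrefix (fun j k hjk => searchWord_mono (word_prefix_word _ hjk))
      (exists_le_length_searchWord (by simpa only [decide_eq_true_eq])
        fun n => by simpa only [hR_iff, decide_eq_true_eq] using h x n)
  choose G hG using hlim
  have hsearch := primrec_searchWord (d := fun u n => decide (d u n)) (hd.of_eq fun _ => by congr)
  refine ⟨G, ⟨_, hsearch, fun u v => searchWord_mono, hG⟩, fun x n => ?_⟩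
  obtain ⟨k, hk⟩ := hG x (n + 1)
  have hn : n < (word (G x) (n + 1)).length := by rw [word_length]; exact n.lt_succ_self
  rw [hR_iff, ← getD_word (G x) n.lt_succ_self, ← getD_eq_of_isPrefix hk hn]
  simpa only [decide_eq_true_eq] using
    exists_of_lt_length_searchWord _ k (hn.trans_le hk.length_le)

theorem Semidecidable.exists_uniformization {R : P × ℕ → Prop} (hR : Semidecidable R)
    (h : ∀ x, ∃ n, R (x, n)) : ∃ g : P → ℕ, ComputableMap g ∧ ∀ x, R (x, g x) := by
  obtain ⟨G, hG, hRG⟩ := exists_search (R := fun x : (P × ℕ) × ℕ => R (x.1.1, x.2)) (by fun_prop)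
    fun x _ => h x
  exact ⟨fun x => name (G x) 0, by fun_prop, fun x => hRG x 0⟩

theorem ComputableMap.of_graph {f : P → ℕ} (hf : Semidecidable fun x : P × ℕ => f x.1 = x.2) :
    ComputableMap f := by
  obtain ⟨g, hg, hfg⟩ := hf.exists_uniformization fun x => ⟨f x, rfl⟩
  exact (show f = g from funext hfg) ▸ hg

theorem ComputableMap.curry {f : P × ℕ → ℕ} (hf : ComputableMap f) :
    ComputableMap fun x n => f (x, n) := by
  obtain ⟨G, hG, hfG⟩ := Semidecidable.exists_search
    (R := fun x : (P × ℕ) × ℕ => f x.1 = x.2) (by fun_prop) fun x n => ⟨f (x, n), rfl⟩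
  exact (show (fun x n => f (x, n)) = G from funext₂ hfG) ▸ hG

theorem Semidecidable.exists_enumeration {E : P × ℕ → Prop} (hE : Semidecidable E)
    (h : ∀ x, ∃ m, E (x, m)) :
    ∃ e : P × ℕ → ℕ, ComputableMap e ∧ ∀ x m, E (x, m) ↔ ∃ i, e (x, i) = m := by
  obtain ⟨D, hD, hD', hED⟩ := hE.exists_decidable
  -- Stage `⟨m, k⟩` lists `m` if `D` confirms it at `k`, and else an element found by a search.
  let stage (x : P × ℕ) : (P × ℕ) × ℕ := ((x.1, x.2.unpair.1), x.2.unpair.2)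
  have hstage : ComputableMap fun x : (P × ℕ) × ℕ => stage x.1 := by simp only [stage]; fun_prop
  obtain ⟨e, he, hDe⟩ := exists_uniformization
    (R := fun x : (P × ℕ) × ℕ =>
      (D (stage x.1) ∧ x.2 = x.1.2.unpair.1) ∨ (¬D (stage x.1) ∧ E (x.1.1, x.2)))
    (.or (.and (hD.comp hstage) (by fun_prop)) (.and (hD'.comp hstage) (by fun_prop)))
    fun x => by
      by_cases hx : D (stage x)
      · exact ⟨x.2.unpair.1, .inl ⟨hx, rfl⟩⟩
      · exact (h x.1).imp fun m hm => .inr ⟨hx, hm⟩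
  refine ⟨e, he, fun x m => ⟨fun hm => ?_, ?_⟩⟩
  · obtain ⟨k, hk⟩ := (hED _).1 hm
    refine ⟨Nat.pair m k, ?_⟩
    simpa [stage, hk] using hDe (x, Nat.pair m k)
  · rintro ⟨i, rfl⟩
    rcases hDe (x, i) with ⟨hi, hm : e (x, i) = _⟩ | ⟨-, hm⟩
    · exact hm ▸ (hED _).2 ⟨_, hi⟩
    · exact hm

theorem ComputableMap.of_computable {f : ℕ → ℕ} (hf : Computable f) : ComputableMap f := by
  obtain ⟨c, hc⟩ := Nat.Partrec.Code.exists_code.1 (Partrec.nat_iff.1 hf)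
  have hgraph (n m : ℕ) : f n = m ↔ ∃ k, c.evaln k n = some m := by
    have hmem : m ∈ c.eval n ↔ m = f n := by simp [hc]
    exact eq_comm.trans (hmem.symm.trans Nat.Partrec.Code.evaln_complete)
  have hstep : PrimrecPred fun a : ℕ =>
      c.evaln a.unpair.2 a.unpair.1.unpair.1 = some a.unpair.1.unpair.2 := by
    have prim_inner := Primrec.unpair.comp (Primrec.fst.comp Primrec.unpair)
    exact Primrec.eq.comp (Nat.Partrec.Code.primrec_evaln.comp
      (((Primrec.snd.comp Primrec.unpair).pair (.const c)).pair (Primrec.fst.comp prim_inner)))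
      (Primrec.option_some.comp (Primrec.snd.comp prim_inner))
  refine of_graph (.of_iff (R := fun x : ℕ × ℕ => ∃ k, c.evaln k x.1 = some x.2) ?_
    fun x => hgraph x.1 x.2)
  have : Semidecidable fun x : (ℕ × ℕ) × ℕ => c.evaln x.2 x.1.1 = some x.1.2 := by
    simpa using (Semidecidable.of_primrecPred hstep).comp (f := fun x : (ℕ × ℕ) × ℕ =>
      Nat.pair (Nat.pair x.1.1 x.1.2) x.2) (by fun_prop)
  fun_prop

end Search

section Names

open Named

variable {P : Type*} [Named P]

/-- The triple `⟨p, q, r⟩` of names; its components are read off by `proj3`. -/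
def tripleName (p q r : Baire) : Baire := fun n =>
  if n % 3 = 0 then p (n / 3) else if n % 3 = 1 then q (n / 3) else r (n / 3)

@[simp]
theorem proj3_tripleName_zero (p q r : Baire) : proj3 (tripleName p q r) 0 = p := by
  funext n
  simp [proj3, tripleName]

@[simp]
theorem proj3_tripleName_one (p q r : Baire) : proj3 (tripleName p q r) 1 = q := by
  funext n
  simp [proj3, tripleName, Nat.add_mod, show (3 * n + 1) / 3 = n by lia]

@[simp]
theorem proj3_tripleName_two (p q r : Baire) : proj3 (tripleName p q r) 2 = r := by
  funext n
  simp [proj3, tripleName, Nat.add_mod, show (3 * n + 2) / 3 = n by lia]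

/-- The infinite tuple `⟨s 0, s 1, …⟩` of names; its components are read off by `projω`. -/
def seqName (s : ℕ → Baire) : Baire := fun n => s n.unpair.1 n.unpair.2

@[simp]
theorem projω_seqName (s : ℕ → Baire) (j : ℕ) : projω (seqName s) j = s j := by
  funext n
  simp [projω, seqName]

@[fun_prop]
protected theorem ComputableMap.pairName {f g : P → Baire} (hf : ComputableMap f)
    (hg : ComputableMap g) : ComputableMap fun x => pairName (f x) (g x) :=
  comp (computableMap_of_name_eq (f := fun x : Baire × Baire => pairName x.1 x.2) fun _ => rfl)
    (hf.prodMk hg)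

@[fun_prop]
protected theorem ComputableMap.proj2 {f : P → Baire} (hf : ComputableMap f) (j : ℕ) :
    ComputableMap fun x => proj2 (f x) j :=
  curry (f := fun x : P × ℕ => name (f x.1) (2 * x.2 + j)) (by fun_prop)

@[fun_prop]
protected theorem ComputableMap.proj3 {f : P → Baire} (hf : ComputableMap f) (j : ℕ) :
    ComputableMap fun x => proj3 (f x) j :=
  curry (f := fun x : P × ℕ => name (f x.1) (3 * x.2 + j)) (by fun_prop)

@[fun_prop]
protected theorem ComputableMap.projω {f : P → Baire} (hf : ComputableMap f) {g : P → ℕ}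
    (hg : ComputableMap g) : ComputableMap fun x => projω (f x) (g x) :=
  curry (f := fun x : P × ℕ => name (f x.1) (Nat.pair (g x.1) x.2)) (by fun_prop)

@[fun_prop]
protected theorem ComputableMap.ite {c : P → Prop} [DecidablePred c] (hc : Semidecidable c)
    (hc' : Semidecidable fun x => ¬c x) {f g : P → ℕ} (hf : ComputableMap f)
    (hg : ComputableMap g) : ComputableMap fun x => if c x then f x else g x := by
  refine of_graph (.of_iff (R := fun x : P × ℕ =>
    (c x.1 ∧ f x.1 = x.2) ∨ (¬c x.1 ∧ g x.1 = x.2)) ?_ fun x => by split_ifs <;> simp_all)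
  exact .or (.and (hc.comp .fst) (by fun_prop)) (.and (hc'.comp .fst) (by fun_prop))

@[fun_prop]
theorem Semidecidable.ne {f g : P → ℕ} (hf : ComputableMap f) (hg : ComputableMap g) :
    Semidecidable fun x => ¬f x = g x := of_primrecRel_nat Primrec.eq.not hf hg

@[fun_prop]
protected theorem ComputableMap.tripleName {f g h : P → Baire} (hf : ComputableMap f)
    (hg : ComputableMap g) (hh : ComputableMap h) :
    ComputableMap fun x => tripleName (f x) (g x) (h x) :=
  curry (f := fun x : P × ℕ => if x.2 % 3 = 0 then name (f x.1) (x.2 / 3) else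
    if x.2 % 3 = 1 then name (g x.1) (x.2 / 3) else name (h x.1) (x.2 / 3)) (by fun_prop)

@[fun_prop]
protected theorem ComputableMap.seqName {f : P → ℕ → Baire}
    (hf : ComputableMap fun x : P × ℕ => f x.1 x.2) : ComputableMap fun x => seqName (f x) := by
  exact curry (f := fun x : P × ℕ => name (f x.1 x.2.unpair.1) x.2.unpair.2) (by fun_prop)

theorem Semidecidable.exists_enumeration_succ {E : P × ℕ → Prop} (hE : Semidecidable E) :
    ∃ e : P × ℕ → ℕ, ComputableMap e ∧ ∀ x m, E (x, m) ↔ ∃ i, e (x, i) = m + 1 := by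
  obtain ⟨e, he, hEe⟩ := exists_enumeration
    (E := fun x : P × ℕ => x.2 = 0 ∨ E (x.1, x.2 - 1)) (by fun_prop) fun _ => ⟨0, .inl rfl⟩
  exact ⟨e, he, fun x m => by simpa using hEe x (m + 1)⟩

theorem iUnion_shiftNum {X : Type*} {α : ℕ → Set X} {E : ℕ → Prop} {e : ℕ → ℕ}
    (h : ∀ m, E m ↔ ∃ i, e i = m + 1) : ⋃ i, shiftNum α (e i) = ⋃ (m) (_ : E m), α m := by
  ext x
  simp only [Set.mem_iUnion]
  constructor
  · rintro ⟨i, hi⟩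
    rcases hm : e i with _ | m <;> rw [hm] at hi
    · exact hi.elim
    · exact ⟨m, (h m).2 ⟨i, hm⟩, hi⟩
  · rintro ⟨m, hm, hx⟩
    obtain ⟨i, hi⟩ := (h m).1 hm
    exact ⟨i, hi ▸ hx⟩

end Names

section Reals

variable {P Q : Type*} [Named P] [Named Q]

theorem exists_nuQ_eq (q : ℚ) : ∃ n, nuQ n = q := by
  refine ⟨Nat.pair (Nat.pair q.num.toNat (-q.num).toNat) (q.den - 1), ?_⟩
  have hnum : ((q.num.toNat : ℚ) - ((-q.num).toNat : ℚ)) = q.num := by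
    exact_mod_cast Int.toNat_sub_toNat_neg q.num
  have hden : ((q.den - 1 : ℕ) : ℚ) + 1 = q.den := by
    exact_mod_cast Nat.sub_add_cancel q.pos
  simp only [nuQ, Nat.unpair_pair, hnum, hden, Rat.num_div_den]

theorem exists_nuQ_btwn {a b : ℝ} (h : a < b) : ∃ n, a < nuQ n ∧ (nuQ n : ℝ) < b := by
  obtain ⟨q, hq⟩ := exists_rat_btwn h
  obtain ⟨n, rfl⟩ := exists_nuQ_eq q
  exact ⟨n, hq⟩

theorem nuQ_zero : nuQ 0 = 0 := by simp [nuQ]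

theorem nuQpos_pos (n : ℕ) : 0 < nuQpos n := by
  rw [nuQpos]
  positivity

theorem nuQpos_eq_nuQ (n : ℕ) :
    nuQpos n = nuQ (Nat.pair (Nat.pair (n.unpair.1 + 1) 0) n.unpair.2) := by
  simp [nuQ, nuQpos]

theorem two_inv_pow_eq_nuQ (n : ℕ) :
    (2 : ℝ)⁻¹ ^ n = nuQ (Nat.pair (Nat.pair 1 0) (2 ^ n - 1)) := by
  simp [nuQ, Nat.cast_sub Nat.one_le_two_pow]

/-- An index of the difference of the rational numbers with indices `m` and `n`. -/
def subIndex (m n : ℕ) : ℕ :=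
  Nat.pair (Nat.pair
    (m.unpair.1.unpair.1 * (n.unpair.2 + 1) + n.unpair.1.unpair.2 * (m.unpair.2 + 1))
    (m.unpair.1.unpair.2 * (n.unpair.2 + 1) + n.unpair.1.unpair.1 * (m.unpair.2 + 1)))
    ((m.unpair.2 + 1) * (n.unpair.2 + 1) - 1)

theorem nuQ_subIndex (m n : ℕ) : nuQ (subIndex m n) = nuQ m - nuQ n := by
  have hden : (((m.unpair.2 + 1) * (n.unpair.2 + 1) - 1 : ℕ) : ℚ) + 1 =
      (m.unpair.2 + 1) * (n.unpair.2 + 1) := by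
    exact_mod_cast Nat.sub_add_cancel (Nat.mul_pos m.unpair.2.succ_pos n.unpair.2.succ_pos)
  simp only [nuQ, subIndex, Nat.unpair_pair, hden]
  rw [div_sub_div _ _ (by positivity) (by positivity)]
  push_cast
  ring

theorem nuQ_lt_nuQ_iff (m n : ℕ) : nuQ m < nuQ n ↔
    m.unpair.1.unpair.1 * (n.unpair.2 + 1) + n.unpair.1.unpair.2 * (m.unpair.2 + 1) <
      n.unpair.1.unpair.1 * (m.unpair.2 + 1) + m.unpair.1.unpair.2 * (n.unpair.2 + 1) := by
  rw [nuQ, nuQ, div_lt_div_iff₀ (by positivity) (by positivity), sub_mul, sub_mul,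
    sub_lt_sub_iff]
  exact_mod_cast Iff.rfl

@[fun_prop]
theorem ComputableMap.subIndex {f g : P → ℕ} (hf : ComputableMap f) (hg : ComputableMap g) :
    ComputableMap fun x => subIndex (f x) (g x) := by
  simp only [Dugundji.subIndex]
  fun_prop

theorem semidecidable_nuQ_lt {f g : P → ℕ} (hf : ComputableMap f) (hg : ComputableMap g) :
    Semidecidable fun x => (nuQ (f x) : ℝ) < nuQ (g x) := by
  simp only [Rat.cast_lt, nuQ_lt_nuQ_iff]
  fun_prop

/-- The real number `t x` can be approximated from below, uniformly in names of `x`. -/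
def LowerSemicomputable (t : P → ℝ) : Prop :=
  Semidecidable fun x : P × ℕ => (nuQ x.2 : ℝ) < t x.1

/-- The real number `t x` can be approximated from above, uniformly in names of `x`. -/
def UpperSemicomputable (t : P → ℝ) : Prop :=
  Semidecidable fun x : P × ℕ => t x.1 < nuQ x.2

variable {s t : P → ℝ}

theorem LowerSemicomputable.comp (ht : LowerSemicomputable t) {f : Q → P} (hf : ComputableMap f) :
    LowerSemicomputable fun x => t (f x) :=
  Semidecidable.comp (R := fun x : P × ℕ => (nuQ x.2 : ℝ) < t x.1) ht
    (f := fun x : Q × ℕ => (f x.1, x.2)) (by fun_prop)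

theorem UpperSemicomputable.semidecidable_lt (hs : UpperSemicomputable s)
    (ht : LowerSemicomputable t) : Semidecidable fun x => s x < t x :=
  (Semidecidable.and hs ht).exists_nat.of_iff fun _ =>
    ⟨exists_nuQ_btwn, fun ⟨_, hs, ht⟩ => hs.trans ht⟩

theorem LowerSemicomputable.neg (ht : LowerSemicomputable t) :
    UpperSemicomputable fun x => -t x := by
  refine (Semidecidable.comp (R := fun x : P × ℕ => (nuQ x.2 : ℝ) < t x.1) ht
    (f := fun x => (x.1, subIndex 0 x.2)) (by fun_prop)).of_iff fun x => ?_
  simp only [nuQ_subIndex, nuQ_zero, zero_sub, Rat.cast_neg, neg_lt]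

theorem UpperSemicomputable.neg (ht : UpperSemicomputable t) :
    LowerSemicomputable fun x => -t x := by
  refine (Semidecidable.comp (R := fun x : P × ℕ => t x.1 < nuQ x.2) ht
    (f := fun x => (x.1, subIndex 0 x.2)) (by fun_prop)).of_iff fun x => ?_
  simp only [nuQ_subIndex, nuQ_zero, zero_sub, Rat.cast_neg, lt_neg]

theorem UpperSemicomputable.add (hs : UpperSemicomputable s) (ht : UpperSemicomputable t) :
    UpperSemicomputable fun x => s x + t x := by
  have hs' := Semidecidable.comp (R := fun x : P × ℕ => s x.1 < nuQ x.2) hs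
    (f := fun x : (P × ℕ) × ℕ => (x.1.1, x.2)) (by fun_prop)
  have ht' := Semidecidable.comp (R := fun x : P × ℕ => t x.1 < nuQ x.2) ht
    (f := fun x : (P × ℕ) × ℕ => (x.1.1, subIndex x.1.2 x.2)) (by fun_prop)
  refine (hs'.and ht').exists_nat.of_iff fun x => ?_
  simp only [nuQ_subIndex, Rat.cast_sub, lt_sub_comm (a := t x.1)]
  exact lt_sub_iff_add_lt.symm.trans ⟨exists_nuQ_btwn, fun ⟨_, hs, ht⟩ => hs.trans ht⟩

theorem LowerSemicomputable.add (hs : LowerSemicomputable s) (ht : LowerSemicomputable t) :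
    LowerSemicomputable fun x => s x + t x := by
  simpa only [neg_add, neg_neg] using (hs.neg.add ht.neg).neg

theorem UpperSemicomputable.nuQ {f : P → ℕ} (hf : ComputableMap f) :
    UpperSemicomputable fun x => (nuQ (f x) : ℝ) := semidecidable_nuQ_lt (by fun_prop) .snd

theorem LowerSemicomputable.nuQ {f : P → ℕ} (hf : ComputableMap f) :
    LowerSemicomputable fun x => (nuQ (f x) : ℝ) := semidecidable_nuQ_lt .snd (by fun_prop)

theorem UpperSemicomputable.nuQpos {f : P → ℕ} (hf : ComputableMap f) :
    UpperSemicomputable fun x => (nuQpos (f x) : ℝ) := by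
  simp only [nuQpos_eq_nuQ]
  exact .nuQ (by fun_prop)

theorem LowerSemicomputable.nuQpos {f : P → ℕ} (hf : ComputableMap f) :
    LowerSemicomputable fun x => (nuQpos (f x) : ℝ) := by
  simp only [nuQpos_eq_nuQ]
  exact .nuQ (by fun_prop)

theorem UpperSemicomputable.two_inv_pow {f : P → ℕ} (hf : ComputableMap f) :
    UpperSemicomputable fun x => (2 : ℝ)⁻¹ ^ f x := by
  simp only [two_inv_pow_eq_nuQ]
  exact .nuQ (by fun_prop)

theorem LowerSemicomputable.two_inv_pow {f : P → ℕ} (hf : ComputableMap f) :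
    LowerSemicomputable fun x => (2 : ℝ)⁻¹ ^ f x := by
  simp only [two_inv_pow_eq_nuQ]
  exact .nuQ (by fun_prop)

theorem UpperSemicomputable.of_abs_sub_le {u : P × ℕ → ℝ} (hu : UpperSemicomputable u)
    (h : ∀ x k, |t x - u (x, k)| ≤ 2⁻¹ ^ k) : UpperSemicomputable t := by
  have hbound := hu.add (.two_inv_pow .snd)
  refine (Semidecidable.comp hbound
    (f := fun x : (P × ℕ) × ℕ => ((x.1.1, x.2), x.1.2)) (by fun_prop)).exists_nat.of_iff
    fun x => ⟨fun hlt => ?_, fun ⟨k, hk⟩ => ?_⟩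
  · obtain ⟨k, hk⟩ := exists_pow_lt_of_lt_one (half_pos (sub_pos.2 hlt))
      (show (2 : ℝ)⁻¹ < 1 by norm_num)
    have := (abs_le.1 (h x.1 k)).1
    exact ⟨k, by dsimp only; linarith⟩
  · have := (abs_le.1 (h x.1 k)).2
    dsimp only at hk
    linarith

theorem LowerSemicomputable.of_abs_sub_le {u : P × ℕ → ℝ} (hu : LowerSemicomputable u)
    (h : ∀ x k, |t x - u (x, k)| ≤ 2⁻¹ ^ k) : LowerSemicomputable t := by
  have hneg : UpperSemicomputable fun x => -t x :=
    .of_abs_sub_le hu.neg fun x k => by rw [neg_sub_neg, abs_sub_comm]; exact h x k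
  simpa only [neg_neg] using hneg.neg

end Reals

section Refinement

variable {X : Type*} [MetricSpace X] {ν : ℕ → X} {c : ℕ → X} {r : ℕ → ℝ}

/-- The center of the basic ball `ballNum ν m`. -/
def center (ν : ℕ → X) (m : ℕ) : X := ν m.unpair.1

/-- The radius of the basic ball `ballNum ν m`. -/
def radius (m : ℕ) : ℝ := nuQpos m.unpair.2

theorem radius_pos (m : ℕ) : 0 < radius m := Rat.cast_pos.2 (nuQpos_pos _)

theorem mem_ballNum {x : X} {m : ℕ} : x ∈ ballNum ν m ↔ dist x (center ν m) < radius m := Iff.rfl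

theorem exists_mem_ballNum_radius_lt (hν : DenseRange ν) (x : X) {ε : ℝ} (hε : 0 < ε) :
    ∃ m, x ∈ ballNum ν m ∧ radius m < ε := by
  obtain ⟨k, hk⟩ := exists_pow_lt_of_lt_one hε (show (2 : ℝ)⁻¹ < 1 by norm_num)
  obtain ⟨i, hi⟩ := hν.exists_dist_lt x (show (0 : ℝ) < 2⁻¹ ^ k by positivity)
  have hradius : radius (Nat.pair i (Nat.pair 0 (2 ^ k - 1))) = 2⁻¹ ^ k := by
    simp [radius, nuQpos, Nat.cast_sub Nat.one_le_two_pow]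
  refine ⟨_, mem_ballNum.2 ?_, hradius.trans_lt hk⟩
  rwa [hradius, center, Nat.unpair_pair]

/-- The refinement of a sequence of balls `B(c n; r n)`: from the `n`-th ball, the points of depth
at least `2⁻¹ ^ n` in an earlier ball are removed. -/
def refinement (c : ℕ → X) (r : ℕ → ℝ) (n : ℕ) : Opens X where
  carrier := {x | dist x (c n) < r n ∧ ∀ l < n, r l < dist x (c l) + 2⁻¹ ^ n}
  is_open' := by
    have hlt : IsOpen {x | ∀ l < n, r l < dist x (c l) + 2⁻¹ ^ n} := by
      simp only [Set.ofPred_forall]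
      exact (Set.finite_lt_nat n).isOpen_biInter fun l _ => isOpen_lt (by fun_prop) (by fun_prop)
    exact (isOpen_lt (by fun_prop) (by fun_prop) : IsOpen {x | dist x (c n) < r n}).inter hlt

theorem refinement_subset_ball (n : ℕ) : (refinement c r n : Set X) ⊆ Metric.ball (c n) (r n) :=
  fun _ hx => hx.1

theorem iUnion_refinement : ⋃ n, (refinement c r n : Set X) = ⋃ n, Metric.ball (c n) (r n) := by
  refine (Set.iUnion_mono refinement_subset_ball).antisymm fun x hx => ?_
  have hex : ∃ n, dist x (c n) < r n := Set.mem_iUnion.1 hx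
  classical
  refine Set.mem_iUnion.2 ⟨Nat.find hex, Nat.find_spec hex, fun l hl => ?_⟩
  exact lt_add_of_le_of_pos (not_lt.1 (Nat.find_min hex hl)) (by positivity)

/-- The ball `B(a; ρ)` is contained in one of the first `N` balls `B(c l; r l)`, formally to depth
`2⁻¹ ^ N`. -/
def IsDeep (c : ℕ → X) (r : ℕ → ℝ) (N : ℕ) (a : X) (ρ : ℝ) : Prop :=
  ∃ l < N, dist a (c l) + ρ + 2⁻¹ ^ N < r l

theorem IsDeep.ball_subset {N : ℕ} {a : X} {ρ : ℝ} (h : IsDeep c r N a ρ) :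
    Metric.ball a ρ ⊆ ⋃ n, Metric.ball (c n) (r n) := by
  obtain ⟨l, -, hl⟩ := h
  have hpos : (0 : ℝ) < 2⁻¹ ^ N := by positivity
  exact (Metric.ball_subset_ball' (by linarith)).trans (Set.subset_iUnion_of_subset l le_rfl)

theorem IsDeep.lt_of_nonempty_inter {N j : ℕ} {a : X} {ρ : ℝ} (h : IsDeep c r N a ρ)
    (hj : ((refinement c r j : Set X) ∩ Metric.ball a ρ).Nonempty) : j < N := by
  obtain ⟨l, hlN, hl⟩ := h
  obtain ⟨x, hx, hxa⟩ := hj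
  by_contra! hNj
  have hdepth := hx.2 l (hlN.trans_le hNj)
  have hpow : (2 : ℝ)⁻¹ ^ j ≤ 2⁻¹ ^ N := pow_le_pow_of_le_one (by norm_num) (by norm_num) hNj
  linarith [dist_triangle x a (c l), Metric.mem_ball.1 hxa]

theorem exists_isDeep_of_mem_ball (hν : DenseRange ν) {x : X} {l : ℕ}
    (hx : x ∈ Metric.ball (c l) (r l)) :
    ∃ m N, x ∈ ballNum ν m ∧ IsDeep c r N (center ν m) (radius m) := by
  have hgap : 0 < (r l - dist x (c l)) / 3 := by linarith [Metric.mem_ball.1 hx]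
  obtain ⟨m, hxm, hm⟩ := exists_mem_ballNum_radius_lt hν x hgap
  have hpow : ∀ᶠ N in atTop, (2 : ℝ)⁻¹ ^ N < (r l - dist x (c l)) / 3 :=
    (tendsto_pow_atTop_nhds_zero_of_lt_one (by norm_num) (by norm_num)).eventually_lt_const hgap
  obtain ⟨N, hN, hlN⟩ := (hpow.and (eventually_gt_atTop l)).exists
  refine ⟨m, N, hxm, l, hlN, ?_⟩
  linarith [mem_ballNum.1 hxm, dist_triangle_left (center ν m) (c l) x]

theorem iUnion_refinement_eq_iUnion_isDeep (hν : DenseRange ν) :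
    ⋃ n, (refinement c r n : Set X) =
      ⋃ (m) (_ : ∃ N, IsDeep c r N (center ν m) (radius m)), ballNum ν m := by
  rw [iUnion_refinement]
  refine Set.Subset.antisymm (Set.iUnion_subset fun l x hx => ?_)
    (Set.iUnion₂_subset fun m ⟨N, hm⟩ => hm.ball_subset)
  obtain ⟨m, N, hxm, hm⟩ := exists_isDeep_of_mem_ball hν hx
  exact Set.mem_iUnion₂.2 ⟨m, ⟨N, hm⟩, hxm⟩

theorem lf_refinement (hν : DenseRange ν) : LF (shiftNum (ballNum ν)) (refinement c r) := by
  intro x i hx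
  obtain ⟨m, N, hxm, hm⟩ := exists_isDeep_of_mem_ball hν (refinement_subset_ball i hx)
  exact ⟨m + 1, Finset.range N, hxm, fun j hj => by simpa using hm.lt_of_nonempty_inter hj⟩

theorem refinement_eq_iUnion_ballNum (hν : DenseRange ν) (n : ℕ) :
    (refinement c r n : Set X) = ⋃ (m) (_ : dist (center ν m) (c n) + radius m < r n ∧
      ∀ l < n, r l + radius m < dist (center ν m) (c l) + 2⁻¹ ^ n), ballNum ν m := by
  have small {a b : ℝ} (h : a < b) : ∀ᶠ ε in 𝓝[>] (0 : ℝ), a + 2 * ε < b :=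
    (ContinuousAt.eventually_lt (f := fun ε => a + 2 * ε) (by fun_prop) continuousAt_const
      (by simpa)).filter_mono nhdsWithin_le_nhds
  refine Set.Subset.antisymm (fun x hx => ?_) (Set.iUnion₂_subset fun m hm x hx => ?_)
  · obtain ⟨ε, hε, hn, hl⟩ := ((eventually_mem_nhdsWithin (s := Set.Ioi 0)).and ((small hx.1).and
      ((Set.finite_lt_nat n).eventually_all.2 fun l hl => small (hx.2 l hl)))).exists
    obtain ⟨m, hxm, hm⟩ := exists_mem_ballNum_radius_lt hν x hε
    have hxm' := mem_ballNum.1 hxm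
    refine Set.mem_iUnion₂.2 ⟨m, ⟨?_, fun l hln => ?_⟩, hxm⟩
    · linarith [dist_triangle_left (center ν m) (c n) x]
    · linarith [dist_triangle x (center ν m) (c l), hl l hln]
  · have hx' := mem_ballNum.1 hx
    refine ⟨?_, fun l hl => ?_⟩
    · linarith [dist_triangle x (center ν m) (c n), hm.1]
    · linarith [dist_triangle_left (center ν m) (c l) x, hm.2 l hl]

end Refinement

section DugundjiSystems

variable {X : Type*} [MetricSpace X] {ν : ℕ → X} {A : Closeds X}

theorem isDugundjiSystem_of_subset_ball (hA : (A : Set X).Nonempty) {c : ℕ → X} {r : ℕ → ℝ}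
    (hr : ∀ n, 4 * r n < Metric.infDist (c n) (A : Set X)) {V : ℕ → Opens X}
    (hV : ∀ n, (V n : Set X) ⊆ Metric.ball (c n) (r n)) (hLF : LF (shiftNum (ballNum ν)) V)
    (hVA : ⋃ n, (V n : Set X) = (A : Set X)ᶜ) {y : ℕ → X} (hyA : ∀ n, y n ∈ A)
    (hy : ∀ n, dist (c n) (y n) ≤ Metric.infDist (c n) (A : Set X) + r n) :
    IsDugundjiSystem ν 1 A V y := by
  have lt_infDist {n : ℕ} {x : X} (hx : x ∈ V n) : 3 * r n < Metric.infDist x (A : Set X) := by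
    have := Metric.mem_ball'.1 (hV n hx)
    linarith [hr n, Metric.infDist_le_infDist_add_dist (s := (A : Set X)) (x := c n) (y := x)]
  have ediam_le (n : ℕ) : Metric.ediam (V n : Set X) ≤ setDist (V n : Set X) (A : Set X) := by
    refine Metric.ediam_le fun x hx x' hx' => le_iInf₂ fun z hz => le_iInf₂ fun a ha => ?_
    rw [edist_dist, edist_dist]
    refine ENNReal.ofReal_le_ofReal ?_
    linarith [Metric.mem_ball.1 (hV n hx), Metric.mem_ball.1 (hV n hx'), lt_infDist hz,
      Metric.infDist_le_dist_of_mem (x := z) ha, dist_triangle_right x x' (c n),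
      dist_nonneg (x := x) (y := c n)]
  refine ⟨hA, hLF, hVA, hyA, fun n x hx => ?_, fun n hn => ?_⟩
  · linarith [Metric.mem_ball.1 (hV n hx), lt_infDist hx, hy n, dist_triangle x (c n) (y n),
      Metric.infDist_le_infDist_add_dist (s := (A : Set X)) (x := c n) (y := x),
      dist_comm x (c n)]
  · exact tendsto_of_tendsto_of_tendsto_of_le_of_le tendsto_const_nhds hn (fun _ => zero_le)
      fun i => ediam_le (n i)

theorem frontier_subset_closure_range {ε : ℝ} {V : ℕ → Opens X} {y : ℕ → X}
    (h : IsDugundjiSystem ν ε A V y) : frontier (A : Set X) ⊆ closure (Set.range y) := by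
  obtain ⟨-, -, hVA, -, hy, -⟩ := h
  intro x hx
  rw [frontier_eq_closure_inter_closure] at hx
  obtain ⟨hxA, hxAc⟩ := hx
  rw [A.isClosed.closure_eq] at hxA
  refine Metric.mem_closure_iff.2 fun δ hδ => ?_
  have hden : 0 < 2 + |ε| := by positivity
  obtain ⟨z, hzA, hxz⟩ := Metric.mem_closure_iff.1 hxAc (δ / (2 + |ε|)) (by positivity)
  obtain ⟨i, hi⟩ := Set.mem_iUnion.1 (hVA ▸ hzA)
  refine ⟨y i, Set.mem_range_self i, ?_⟩
  have hzy : dist z (y i) ≤ (1 + |ε|) * dist x z :=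
    (hy i z hi).trans (mul_le_mul (by gcongr; exact le_abs_self ε)
      (dist_comm z x ▸ Metric.infDist_le_dist_of_mem hxA) Metric.infDist_nonneg (by positivity))
  rw [lt_div_iff₀ hden] at hxz
  linarith [dist_triangle x z (y i)]

/-- The ball `ballNum ν m` is small in comparison with its distance from `A`. -/
def IsSmallBall (ν : ℕ → X) (A : Closeds X) (m : ℕ) : Prop :=
  4 * radius m < Metric.infDist (center ν m) (A : Set X)

theorem iUnion_isSmallBall (hν : DenseRange ν) (hA : (A : Set X).Nonempty) :
    ⋃ (m) (_ : IsSmallBall ν A m), ballNum ν m = (A : Set X)ᶜ := by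
  refine Set.Subset.antisymm (Set.iUnion₂_subset fun m hm x hx hxA => ?_) fun x hx => ?_
  · have hm : 4 * radius m < Metric.infDist (center ν m) (A : Set X) := hm
    linarith [Metric.infDist_le_dist_of_mem (x := center ν m) hxA, dist_comm x (center ν m),
      mem_ballNum.1 hx, radius_pos m]
  · have hpos : 0 < Metric.infDist x (A : Set X) := (A.isClosed.notMem_iff_infDist_pos hA).1 hx
    obtain ⟨m, hxm, hm⟩ := exists_mem_ballNum_radius_lt hν x
      (div_pos hpos (by norm_num : (0 : ℝ) < 5))
    refine Set.mem_iUnion₂.2 ⟨m, ?_, hxm⟩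
    rw [IsSmallBall]
    linarith [Metric.infDist_le_infDist_add_dist (s := (A : Set X)) (x := x) (y := center ν m),
      mem_ballNum.1 hxm]

end DugundjiSystems

section Distances

open Named

variable {X : Type*} [MetricSpace X] {ν : ℕ → X} {P : Type*} [Named P]

theorem IsComputableMetricSpace.exists_approx_dist (hν : IsComputableMetricSpace ν) {f g : P → ℕ}
    (hf : ComputableMap f) (hg : ComputableMap g) :
    ∃ a : P × ℕ → ℕ, ComputableMap a ∧
      ∀ x k, |dist (ν (f x)) (ν (g x)) - nuQ (a (x, k))| ≤ (2 : ℝ)⁻¹ ^ k := by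
  obtain ⟨-, a, ha, hdist⟩ := hν
  have ha' : Computable fun n : ℕ => a (n.unpair.1, n.unpair.2.unpair.1, n.unpair.2.unpair.2) := by
    have hsnd := Computable.snd.comp Computable.unpair
    exact ha.comp ((Computable.fst.comp .unpair).pair
      ((Computable.fst.comp (Computable.unpair.comp hsnd)).pair
        (Computable.snd.comp (Computable.unpair.comp hsnd))))
  have := (ComputableMap.of_computable ha').comp
    (f := fun x : P × ℕ => Nat.pair (f x.1) (Nat.pair (g x.1) x.2)) (by fun_prop)
  simp only [Nat.unpair_pair] at this
  exact ⟨_, this, fun x k => (hdist (f x) (g x) k).le⟩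

theorem IsComputableMetricSpace.upperSemicomputable_dist (hν : IsComputableMetricSpace ν)
    {f g : P → ℕ} (hf : ComputableMap f) (hg : ComputableMap g) :
    UpperSemicomputable fun x => dist (ν (f x)) (ν (g x)) := by
  obtain ⟨a, ha, hdist⟩ := hν.exists_approx_dist hf hg
  exact .of_abs_sub_le (.nuQ ha) hdist

theorem IsComputableMetricSpace.lowerSemicomputable_dist (hν : IsComputableMetricSpace ν)
    {f g : P → ℕ} (hf : ComputableMap f) (hg : ComputableMap g) :
    LowerSemicomputable fun x => dist (ν (f x)) (ν (g x)) := by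
  obtain ⟨a, ha, hdist⟩ := hν.exists_approx_dist hf hg
  exact .of_abs_sub_le (.nuQ ha) hdist

theorem dist_le_of_cauchyRep {p : Baire} {y : X} (h : cauchyRep ν p y) (k : ℕ) :
    dist (ν (p k)) y ≤ (2 : ℝ)⁻¹ ^ k := by
  refine le_of_tendsto (tendsto_const_nhds.dist h.2) ?_
  filter_upwards [eventually_ge_atTop k] with i hi
  simpa only [min_eq_left hi] using (h.1 k i).le

theorem cauchyRep_const (a : ℕ) : cauchyRep ν (fun _ => a) (ν a) :=
  ⟨fun i j => by rw [dist_self]; positivity, tendsto_const_nhds⟩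

theorem IsComputableMetricSpace.upperSemicomputable_dist_of_cauchyRep
    (hν : IsComputableMetricSpace ν) {f : P → ℕ} (hf : ComputableMap f) {p : P → Baire}
    (hp : ComputableMap p) {y : P → X} (hy : ∀ x, cauchyRep ν (p x) (y x)) :
    UpperSemicomputable fun x => dist (ν (f x)) (y x) := by
  refine .of_abs_sub_le (hν.upperSemicomputable_dist (f := fun x : P × ℕ => f x.1)
    (g := fun x => name (p x.1) x.2) (by fun_prop) (by fun_prop)) fun x k => ?_
  rw [← Real.dist_eq, dist_comm (ν (f x)), dist_comm (ν (f x))]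
  exact (dist_dist_dist_le_left _ _ _).trans (dist_comm (y x) _ ▸ dist_le_of_cauchyRep (hy x) k)

theorem eta_apply_eq_succ_iff {p r q : Baire} (h : q ∈ eta p r) (i n : ℕ) :
    q i = n + 1 ↔ ∃ k, p (Nat.pair i (Encodable.encode (word r k))) = n + 2 ∧
      ∀ j < k, p (Nat.pair i (Encodable.encode (word r j))) = 0 := by
  obtain ⟨hd, rfl⟩ := h
  simp only [eta]
  constructor
  · intro hq
    refine ⟨Nat.find (hd i), by lia, fun j hj => ?_⟩
    simpa using Nat.find_min (hd i) hj
  · rintro ⟨k, hk, hlt⟩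
    have hfind : Nat.find (hd i) = k := by
      rw [Nat.find_eq_iff]
      exact ⟨by lia, fun j hj => by simp [hlt j hj]⟩
    rw [hfind, hk, Nat.add_succ_sub_one]

-- In `n + 2`, one successor stems from `rhoLower` and one from the encoding of outputs in `eta`.
theorem lt_infDist_iff_of_distRep {q : Baire} {A : Closeds X} (hA : (A : Set X).Nonempty)
    (h : distRep ν q A) (a n : ℕ) : (nuQ n : ℝ) < Metric.infDist (ν a) (A : Set X) ↔
      ∃ i k, q (Nat.pair i (Encodable.encode (word (fun _ => a) k))) = n + 2 ∧
        ∀ j < k, q (Nat.pair i (Encodable.encode (word (fun _ => a) j))) = 0 := by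
  obtain ⟨s, hs, hsA⟩ := h _ _ (cauchyRep_const a)
  have hlower : ((nuQ n : ℝ) : EReal) < (Metric.infEDist (ν a) (A : Set X) : ENNReal) ↔
      ∃ i, s i = n + 1 := Set.ext_iff.1 hsA n
  simp only [← eta_apply_eq_succ_iff hs, ← hlower]
  rw [← ENNReal.ofReal_toReal (Metric.infEDist_ne_top hA), EReal.coe_ennreal_ofReal,
    max_eq_left ENNReal.toReal_nonneg, EReal.coe_lt_coe_iff]
  rfl

@[fun_prop]
theorem ComputableMap.encode_word_const {f g : P → ℕ} (hf : ComputableMap f)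
    (hg : ComputableMap g) :
    ComputableMap fun x => Encodable.encode (word (fun _ => f x) (g x)) :=
  (of_primrec₂ (f := fun a k => Encodable.encode (word (fun _ => a) k)) (Primrec.encode.comp
    (primrec_word (f := fun (x : ℕ × ℕ) _ => x.1) (Primrec.fst.comp .fst) .snd))).comp
    (hf.prodMk hg)

theorem lowerSemicomputable_infDist {A : P → Closeds X} (hA : ∀ x, (A x : Set X).Nonempty)
    {q : P → Baire} (hq : ComputableMap q) (h : ∀ x, distRep ν (q x) (A x)) :
    LowerSemicomputable fun x : P × ℕ => Metric.infDist (ν x.2) (A x.1 : Set X) := by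
  let query (x : P × ℕ) (i k : ℕ) : ℕ :=
    name (q x.1) (Nat.pair i (Encodable.encode (word (fun _ => x.2) k)))
  have hquery : Semidecidable fun x : (((P × ℕ) × ℕ) × ℕ) × ℕ =>
      query x.1.1.1 x.1.2 x.2 = x.1.1.2 + 2 ∧ ∀ j < x.2, query x.1.1.1 x.1.2 j = 0 :=
    .and (by simp only [query]; fun_prop) (Semidecidable.forall_lt
      (R := fun x : ((((P × ℕ) × ℕ) × ℕ) × ℕ) × ℕ => query x.1.1.1.1 x.1.1.2 x.2 = 0)
      (by simp only [query]; fun_prop) (by fun_prop))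
  exact hquery.exists_nat.exists_nat.of_iff fun x =>
    lt_infDist_iff_of_distRep (hA x.1.1) (h x.1.1) _ _

end Distances

section CoverNames

variable {X : Type*} [MetricSpace X] {ν : ℕ → X} {P : Type*} [Named P]

theorem UpperSemicomputable.radius {f : P → ℕ} (hf : ComputableMap f) :
    UpperSemicomputable fun x => radius (f x) := .nuQpos (by fun_prop)

theorem LowerSemicomputable.radius {f : P → ℕ} (hf : ComputableMap f) :
    LowerSemicomputable fun x => radius (f x) := .nuQpos (by fun_prop)

theorem IsComputableMetricSpace.upperSemicomputable_dist_center (hν : IsComputableMetricSpace ν)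
    {f g : P → ℕ} (hf : ComputableMap f) (hg : ComputableMap g) :
    UpperSemicomputable fun x => dist (center ν (f x)) (center ν (g x)) :=
  hν.upperSemicomputable_dist (by fun_prop) (by fun_prop)

theorem IsComputableMetricSpace.lowerSemicomputable_dist_center (hν : IsComputableMetricSpace ν)
    {f g : P → ℕ} (hf : ComputableMap f) (hg : ComputableMap g) :
    LowerSemicomputable fun x => dist (center ν (f x)) (center ν (g x)) :=
  hν.lowerSemicomputable_dist (by fun_prop) (by fun_prop)

theorem Semidecidable.exists_sigmaName {U : P → Opens X} {E : P × ℕ → Prop}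
    (hE : Semidecidable E) (hU : ∀ x, (U x : Set X) = ⋃ (m) (_ : E (x, m)), ballNum ν m) :
    ∃ G : P → Baire, ComputableMap G ∧ ∀ x, sigmaRep ν (G x) (U x) := by
  obtain ⟨e, he, hEe⟩ := hE.exists_enumeration_succ
  exact ⟨fun x i => e (x, i), he.curry, fun x => (hU x).trans (iUnion_shiftNum (hEe x)).symm⟩

/-- The refinement of the sequence of basic balls with indices `b 0, b 1, …`. -/
def ballRefinement (ν : ℕ → X) (b : ℕ → ℕ) : ℕ → Opens X :=
  refinement (fun n => center ν (b n)) fun n => radius (b n)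

theorem exists_sigmaName_ballRefinement (hν : IsComputableMetricSpace ν) {b : P × ℕ → ℕ}
    (hb : ComputableMap b) : ∃ G : P × ℕ → Baire, ComputableMap G ∧
      ∀ x n, sigmaRep ν (G (x, n)) (ballRefinement ν (fun i => b (x, i)) n) := by
  have hinside : Semidecidable fun x : (P × ℕ) × ℕ =>
      dist (center ν x.2) (center ν (b x.1)) + radius x.2 < radius (b x.1) :=
    ((hν.upperSemicomputable_dist_center .snd (by fun_prop)).add (.radius .snd)).semidecidable_lt
      (.radius (by fun_prop))
  have houtside : Semidecidable fun x : (P × ℕ) × ℕ => ∀ l < x.1.2,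
      radius (b (x.1.1, l)) + radius x.2 <
        dist (center ν x.2) (center ν (b (x.1.1, l))) + 2⁻¹ ^ x.1.2 :=
    Semidecidable.forall_lt (R := fun x : ((P × ℕ) × ℕ) × ℕ =>
      radius (b (x.1.1.1, x.2)) + radius x.1.2 <
        dist (center ν x.1.2) (center ν (b (x.1.1.1, x.2))) + 2⁻¹ ^ x.1.1.2)
      (UpperSemicomputable.semidecidable_lt (.add (.radius (by fun_prop)) (.radius (by fun_prop)))
        (.add (hν.lowerSemicomputable_dist_center (by fun_prop) (by fun_prop))
          (.two_inv_pow (by fun_prop)))) (by fun_prop)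
  obtain ⟨G, hG, hsigma⟩ := (hinside.and houtside).exists_sigmaName (ν := ν)
    (U := fun x : P × ℕ => ballRefinement ν (fun i => b (x.1, i)) x.2)
    fun x : P × ℕ => refinement_eq_iUnion_ballNum (c := fun i => center ν (b (x.1, i)))
      (r := fun i => radius (b (x.1, i))) hν.1 x.2
  exact ⟨G, hG, fun x n => hsigma (x, n)⟩

theorem exists_isDeep_enumeration (hν : IsComputableMetricSpace ν) {b : P × ℕ → ℕ}
    (hb : ComputableMap b) : ∃ e : P × ℕ → ℕ, ComputableMap e ∧
      ∀ x m N, IsDeep (fun i => center ν (b (x, i))) (fun i => radius (b (x, i))) N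
        (center ν m) (radius m) ↔ ∃ i, e (x, i) = Nat.pair (m + 1) N := by
  let E (x : P × ℕ) : Prop := ∃ l, l < x.2.unpair.2 ∧
    dist (center ν (x.2.unpair.1 - 1)) (center ν (b (x.1, l))) + radius (x.2.unpair.1 - 1) +
      2⁻¹ ^ x.2.unpair.2 < radius (b (x.1, l))
  have hE : Semidecidable E := .exists (.and (by fun_prop) (UpperSemicomputable.semidecidable_lt
    (.add (.add (hν.upperSemicomputable_dist_center (by fun_prop) (by fun_prop))
      (.radius (by fun_prop))) (.two_inv_pow (by fun_prop))) (.radius (by fun_prop))))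
  obtain ⟨e, he, hEe⟩ := Semidecidable.exists_enumeration
    (E := fun x : P × ℕ => x.2.unpair.1 = 0 ∨ E x) (by fun_prop) fun _ => ⟨0, .inl rfl⟩
  exact ⟨e, he, fun x m N => by simpa [E, IsDeep] using hEe x (Nat.pair (m + 1) N)⟩

-- The number `2 ^ N - 1` is the binary code of the set of all `j < N`.
theorem delta2_tripleName_refinement (hν : DenseRange ν) {c : ℕ → X} {r : ℕ → ℝ} {p : ℕ → Baire}
    (hp : ∀ n, sigmaRep ν (p n) (refinement c r n)) {e : ℕ → ℕ}
    (he : ∀ m N, IsDeep c r N (center ν m) (radius m) ↔ ∃ i, e i = Nat.pair (m + 1) N) :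
    delta2 ν (shiftNum (ballNum ν)) (tripleName (seqName p) (fun i => (e i).unpair.1)
      fun i => 2 ^ (e i).unpair.2 - 1) (refinement c r) := by
  have hcover : ⋃ n, (refinement c r n : Set X) =
      ⋃ i, shiftNum (ballNum ν) (e i).unpair.1 := by
    rw [iUnion_refinement_eq_iUnion_isDeep hν]
    refine (iUnion_shiftNum fun m => ?_).symm
    simp only [he]
    refine ⟨fun ⟨N, i, hi⟩ => ⟨i, by rw [hi, Nat.unpair_pair]⟩, fun ⟨i, hi⟩ => ?_⟩
    exact ⟨(e i).unpair.2, i, by rw [← hi, Nat.pair_unpair]⟩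
  simp only [delta2, delta1, proj3_tripleName_zero, proj3_tripleName_one, proj3_tripleName_two]
  refine ⟨⟨lf_refinement hν, fun n => by simpa using hp n, hcover.le, fun i j hj => ?_⟩, hcover⟩
  rw [Set.mem_ofPred_eq] at hj ⊢
  rcases hm : (e i).unpair.1 with _ | m <;> rw [hm] at hj
  · exact absurd hj.right Set.not_nonempty_empty
  · have hdeep := (he m _).2 ⟨i, by rw [← hm, Nat.pair_unpair]⟩
    simpa using hdeep.lt_of_nonempty_inter hj

theorem exists_delta2Name_ballRefinement (hν : IsComputableMetricSpace ν) {b : P × ℕ → ℕ}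
    (hb : ComputableMap b) : ∃ G : P → Baire, ComputableMap G ∧
      ∀ x, delta2 ν (shiftNum (ballNum ν)) (G x) (ballRefinement ν fun i => b (x, i)) := by
  obtain ⟨p, hp, hsigma⟩ := exists_sigmaName_ballRefinement hν hb
  obtain ⟨e, he, hdeep⟩ := exists_isDeep_enumeration hν hb
  have hcenters : ComputableMap fun (x : P) i => (e (x, i)).unpair.1 :=
    .curry (f := fun x => (e x).unpair.1) (by fun_prop)
  have hcodes : ComputableMap fun (x : P) i => 2 ^ (e (x, i)).unpair.2 - 1 :=
    .curry (f := fun x => 2 ^ (e x).unpair.2 - 1) (by fun_prop)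
  refine ⟨fun x => tripleName (seqName fun n => p (x, n)) (fun i => (e (x, i)).unpair.1)
    fun i => 2 ^ (e (x, i)).unpair.2 - 1, .tripleName (by fun_prop) hcenters hcodes, fun x => ?_⟩
  exact delta2_tripleName_refinement hν.1 (hsigma x) (hdeep x)

end CoverNames

section Reductions

open Named

variable {X : Type*} [MetricSpace X] {ν : ℕ → X} {P : Type*} [Named P]

theorem exists_isSmallBall_enumeration (hν : IsComputableMetricSpace ν) {A : P → Closeds X}
    (hA : ∀ x, A x ∈ properClosed X) {q : P → Baire} (hq : ComputableMap q)
    (hqA : ∀ x, distRep ν (q x) (A x)) : ∃ b : P × ℕ → ℕ, ComputableMap b ∧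
      ∀ x m, IsSmallBall ν (A x) m ↔ ∃ i, b (x, i) = m := by
  have hne (x : P) : (A x : Set X).Nonempty := Set.nonempty_iff_ne_empty.2 (hA x).1
  refine Semidecidable.exists_enumeration (E := fun x : P × ℕ => IsSmallBall ν (A x.1) x.2) ?_
    fun x => ?_
  · have hradius : UpperSemicomputable fun x : P × ℕ => radius x.2 := .radius .snd
    have hinfDist : LowerSemicomputable fun x : P × ℕ =>
        Metric.infDist (center ν x.2) (A x.1 : Set X) :=
      (lowerSemicomputable_infDist hne hq hqA).comp
        (f := fun x : P × ℕ => (x.1, x.2.unpair.1)) (by fun_prop)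
    refine (((hradius.add hradius).add (hradius.add hradius)).semidecidable_lt hinfDist).of_iff
      fun x => ?_
    rw [IsSmallBall, show 4 * radius x.2 = radius x.2 + radius x.2 + (radius x.2 + radius x.2) by
      ring]
  · by_contra! hnone
    refine (hA x).2 (Set.compl_empty_iff.1 ?_)
    rw [← iUnion_isSmallBall hν.1 (hne x)]
    simp [hnone]

theorem exists_nearby_point_selection (hν : IsComputableMetricSpace ν) {A : P → Closeds X}
    (hA : ∀ x, (A x : Set X).Nonempty) {q : P → Baire} (hq : ComputableMap q)
    (hqA : ∀ x, distRep ν (q x) (A x)) {p : P × ℕ → Baire} (hp : ComputableMap p)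
    {y : P → ℕ → X} (hpy : ∀ x j, cauchyRep ν (p (x, j)) (y x j))
    (hyA : ∀ x, (A x : Set X) ⊆ closure (Set.range (y x))) :
    ∃ g : P × ℕ → ℕ, ComputableMap g ∧ ∀ x m, dist (center ν m) (y x (g (x, m))) <
      Metric.infDist (center ν m) (A x : Set X) + radius m := by
  have hdist : UpperSemicomputable fun x : (P × ℕ) × ℕ =>
      dist (center ν x.1.2) (y x.1.1 x.2) :=
    hν.upperSemicomputable_dist_of_cauchyRep (f := fun x : (P × ℕ) × ℕ => x.1.2.unpair.1)
      (by fun_prop) (p := fun x => p (x.1.1, x.2)) (by fun_prop) fun x => hpy x.1.1 x.2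
  have hinfDist : LowerSemicomputable fun x : (P × ℕ) × ℕ =>
      Metric.infDist (center ν x.1.2) (A x.1.1 : Set X) :=
    (lowerSemicomputable_infDist hA hq hqA).comp
      (f := fun x : (P × ℕ) × ℕ => (x.1.1, x.1.2.unpair.1)) (by fun_prop)
  have hnear : Semidecidable fun x : (P × ℕ) × ℕ => dist (center ν x.1.2) (y x.1.1 x.2) <
      Metric.infDist (center ν x.1.2) (A x.1.1 : Set X) + radius x.1.2 :=
    hdist.semidecidable_lt (.add hinfDist (.radius (by fun_prop)))
  obtain ⟨g, hg, hg_near⟩ := hnear.exists_uniformization fun x => by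
    have hle := Metric.infDist_le_infDist_of_subset (x := center ν x.2) (hyA x.1) (hA x.1)
    rw [Metric.infDist_closure] at hle
    obtain ⟨_, ⟨j, rfl⟩, hj⟩ := (Metric.infDist_lt_iff (Set.range_nonempty (y x.1))).1
      (hle.trans_lt (lt_add_of_pos_right _ (radius_pos x.2)))
    exact ⟨j, hj⟩
  exact ⟨g, hg, fun x m => hg_near (x, m)⟩

theorem exists_dense_seq_of_rangeRep {s : Baire} {A : Closeds X} (hA : (A : Set X).Nonempty)
    (h : rangeRep ν s A) : ∃ y : ℕ → X, (∀ j, y j ∈ A) ∧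
      (∀ j, cauchyRep ν (fun k => projω s j k - 1) (y j)) ∧
      (A : Set X) ⊆ closure (Set.range y) := by
  obtain h | ⟨-, hmem, hdense⟩ := h
  · exact absurd h.1 hA.ne_empty
  have unshift {t : Baire} {z : X} (ht : (cauchyRep ν).shift t z) :
      cauchyRep ν (fun k => t k - 1) z := by
    obtain ⟨p, hp, hz⟩ := ht
    simpa only [hp, Nat.add_sub_cancel] using hz
  choose y hyA hy using hmem
  refine ⟨y, hyA, fun j => unshift (hy j), fun x hx => mem_closure_iff.2 fun U hU hxU => ?_⟩
  obtain ⟨i, z, hzU, hz⟩ := hdense x hx U hU hxU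
  obtain rfl : z = y i := tendsto_nhds_unique (unshift hz).2 (unshift (hy i)).2
  exact ⟨y i, hzU, i, rfl⟩

theorem rangeRep_succ {s : Baire} {y : ℕ → X} (h : (cauchyRep ν).seq s y) :
    rangeRep ν (fun n => s n + 1) (Closeds.closure (Set.range y)) := by
  have hshift (i : ℕ) : (cauchyRep ν).shift (projω (fun n => s n + 1) i) (y i) :=
    ⟨projω s i, fun _ => rfl, h i⟩
  refine .inr ⟨(Set.range_nonempty y).closure, fun i => ⟨y i, subset_closure ⟨i, rfl⟩, hshift i⟩,
    fun x hx U hU hxU => ?_⟩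
  obtain ⟨_, hiU, i, rfl⟩ := mem_closure_iff.1 hx U hU hxU
  exact ⟨i, y i, hiU, hshift i⟩

theorem delta4_pairName {A : Closeds X} {V : ℕ → Opens X} {y : ℕ → X}
    (hVy : IsDugundjiSystem ν 1 A V y) {t s : Baire}
    (ht : delta2 ν (shiftNum (ballNum ν)) t V) (hs : (cauchyRep ν).seq s y) :
    delta4 ν (pairName t s) A := by
  have hpi : piSet (V, y) = A := by
    refine Closeds.ext ?_
    rw [piSet, Opens.coe_compl, Opens.coe_iSup, hVy.2.2.1, compl_compl]
  have hmem : (V, y) ∈ systems ν := by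
    rw [systems, Set.mem_ofPred_eq, hpi]
    exact hVy
  exact ⟨(V, y), hmem, hpi, hmem, by rwa [proj2_pairName_zero], by rwa [proj2_pairName_one]⟩

theorem isDugundjiSystem_ballRefinement (hν : DenseRange ν) {A : Closeds X}
    (hA : (A : Set X).Nonempty) {b : ℕ → ℕ} (hb : ∀ m, IsSmallBall ν A m ↔ ∃ i, b i = m)
    {y : ℕ → X} (hyA : ∀ n, y n ∈ A) (hy : ∀ n, dist (center ν (b n)) (y n) ≤
      Metric.infDist (center ν (b n)) (A : Set X) + radius (b n)) :
    IsDugundjiSystem ν 1 A (ballRefinement ν b) y := by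
  refine isDugundjiSystem_of_subset_ball hA (fun n => (hb _).2 ⟨n, rfl⟩) refinement_subset_ball
    (lf_refinement hν) ?_ hyA hy
  rw [iUnion_refinement, ← iUnion_isSmallBall hν hA]
  simp only [hb, Set.iUnion_exists, Set.iUnion_iUnion_eq']
  rfl

theorem range_meet_dist_reducible_delta4 (hν : IsComputableMetricSpace ν) :
    (((rangeRep ν).meet (distRep ν)).restrict (properClosed X)).Reducible
      ((delta4 ν).restrict (properClosed X)) := by
  let P := (((rangeRep ν).meet (distRep ν)).restrict (properClosed X)).Name
  let A (x : P) : Closeds X := x.1.2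
  have hA (x : P) : A x ∈ properClosed X := x.2.1
  have hne (x : P) : (A x : Set X).Nonempty := Set.nonempty_iff_ne_empty.2 (hA x).1
  have hdist (x : P) : distRep ν (proj2 (name x) 1) (A x) := x.2.2.2
  choose y hyA hpy hdense using fun x : P => exists_dense_seq_of_rangeRep (hne x) x.2.2.1
  let point (x : P × ℕ) : Baire := fun k => projω (proj2 (name x.1) 0) x.2 k - 1
  have hpoint : ComputableMap point :=
    .curry (f := fun x : (P × ℕ) × ℕ => name (projω (proj2 (name x.1.1) 0) x.1.2) x.2 - 1)
      (by fun_prop)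
  obtain ⟨b, hb, hsmall⟩ := exists_isSmallBall_enumeration hν hA (by fun_prop) hdist
  obtain ⟨g, hg, hnear⟩ :=
    exists_nearby_point_selection hν hne (by fun_prop) hdist hpoint hpy hdense
  obtain ⟨V, hV, hdelta2⟩ := exists_delta2Name_ballRefinement hν hb
  refine .of_computableMap
    (G := fun x => pairName (V x) (seqName fun n => point (x, g (x, b (x, n)))))
    (by fun_prop) fun x => ⟨hA x, delta4_pairName (isDugundjiSystem_ballRefinement hν.1 (hne x)
      (hsmall x) (fun n => hyA x _) fun n => (hnear x (b (x, n))).le) (hdelta2 x) fun n => ?_⟩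
  rw [projω_seqName]
  exact hpy x _

theorem delta4_reducible_delta8 (ν : ℕ → X) : (delta4 ν).Reducible (delta8 ν) := by
  have hpoints : ComputableMap fun (x : (delta4 ν).Name) n => name (proj2 (name x) 1) n + 1 :=
    .curry (f := fun x : (delta4 ν).Name × ℕ => name (proj2 (name x.1) 1) x.2 + 1) (by fun_prop)
  refine .of_computableMap (G := fun x => pairName
    (fun n => name (proj2 (name x) 1) n + 1) (proj3 (proj2 (name x) 0) 1))
    (.pairName hpoints (by fun_prop)) fun x => ?_
  obtain ⟨⟨V, y⟩, hD, hpi, -, ⟨-, hcover⟩, hy⟩ := x.2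
  replace hD : IsDugundjiSystem ν 1 x.1.2 V y := hpi ▸ hD
  refine ⟨hD.1, ⟨Closeds.closure (Set.range y), frontier_subset_closure_range hD,
    closure_minimal (Set.range_subset_iff.2 hD.2.2.2.1) (Closeds.isClosed _), ?_⟩, ?_⟩
  · rw [proj2_pairName_zero]
    exact rangeRep_succ hy
  · rw [proj2_pairName_one, piRep, sigmaRep, Closeds.coe_compl, ← hD.2.2.1]
    exact hcover

end Reductions

end Dugundji

theorem mainTheorem9 {X : Type*} [MetricSpace X] (ν : ℕ → X)
    (hν : Dugundji.IsComputableMetricSpace ν) :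
    Dugundji.Rep.Reducible
        (((Dugundji.rangeRep ν).meet (Dugundji.distRep ν)).restrict (Dugundji.properClosed X))
        ((Dugundji.delta4 ν).restrict (Dugundji.properClosed X)) ∧
      Dugundji.Rep.Reducible
        ((Dugundji.delta4 ν).restrict (Dugundji.properClosed X))
        ((Dugundji.delta8 ν).restrict (Dugundji.properClosed X)) :=
  ⟨Dugundji.range_meet_dist_reducible_delta4 hν, (Dugundji.delta4_reducible_delta8 ν).restrict _⟩
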